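/- Let $\overline{A}$ be an $n\times n$ real symmetric positive definite matrix such that every entry of $\overline{A}$ is at most $1/n$ and every eigenvalue of $\overline{A}$ is at least $1/\kappa$, for some real $\kappa \ge n^3$. Let $p\le 1$ be a probability with $$p \;\ge\; \frac{300\,\log\kappa\,\log n}{n},$$ where $\log$ is the natural logarithm. Let $A$ be the random symmetric matrix obtained by perturbing $\overline{A}$ as follows: independently for each unordered pair $\{i,j\}$ with $1\le i\le j\le n$ (diagonal positions included), $$A_{ij}=A_{ji}=\begin{cases}\overline{A}_{ij}+\dfrac{1}{n^2\kappa}\,g_{ij} & \text{with probability } p,\\[2mm] \overline{A}_{ij} & \text{with probability } 1-p,\end{cases}$$ where the $g_{ij}$ are independent standard Gaussian $\mathcal N(0,1)$ random variables, independent of the choices of which positions are perturbed. Then with probability at least $1-n^{-10}$, any two of the $n$ eigenvalues of $A$, counted with multiplicity, differ in absolute value by at least $\kappa^{-5\log n}$. -/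

import Mathlib

open MeasureTheory ProbabilityTheory

namespace SparsePerturbation

/-- The law on `ℝ` of a sparse standard Gaussian: it is a draw from `N(0,1)` with probability `p`
and `0` with probability `1 - p` (meaningful for `0 ≤ p ≤ 1`). -/
noncomputable def sparseGaussian (p : ℝ) : Measure ℝ :=
  ENNReal.ofReal p • gaussianReal 0 1 + ENNReal.ofReal (1 - p) • Measure.dirac 0

/-- The matrix obtained from `Abar` by adding `1 / (n² κ)` times the symmetric matrix whose
`(i, j)` and `(j, i)` entries are both `X s(i, j)`. The noise is indexed by unordered pairs
(diagonal included). -/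
noncomputable def perturb {n : ℕ} (Abar : Matrix (Fin n) (Fin n) ℝ) (κ : ℝ)
    (X : Sym2 (Fin n) → ℝ) : Matrix (Fin n) (Fin n) ℝ :=
  Matrix.of fun i j => Abar i j + 1 / ((n : ℝ) ^ 2 * κ) * X s(i, j)

/-- `A` is symmetric, and its eigenvalues, listed with multiplicity, are pairwise at distance at
least `δ`. -/
def EigenvaluesSeparated {n : ℕ} (A : Matrix (Fin n) (Fin n) ℝ) (δ : ℝ) : Prop :=
  ∃ hA : A.IsHermitian, ∀ i j : Fin n, i ≠ j → δ ≤ |hA.eigenvalues i - hA.eigenvalues j|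

end SparsePerturbation

/-! ### Small-ball bounds for a single Gaussian, and the sparse law -/

namespace SparsePerturbation

open scoped ENNReal

/-! Write l = log n, L = log κ and δ = κ^(-5l) = exp(-5Ll). Suppose two eigenvalues of A are
δ-close, with orthonormal eigenvectors v and v', and choose k with |v_k| ≥ 1/n. The combination w =
v'_k v - v_k v' vanishes at k and is still an approximate eigenvector, so the minor without index k
has a true eigenvector u with a nearby eigenvalue. Pairing (A - λ)u with v then forces row k of A to
be almost orthogonal to u (`exists_minor_eigenvector`). The minor does not see the noise of row k,
so u is independent of that row. If u has at least 13l/p coordinates that are not too small, a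
small-ball estimate makes this near-orthogonality improbable (`measure_isColumnObstruction_le`).

It remains to see that u is spread. If k coordinates have size at least a but fewer than 8k have
size at least some much smaller θ, rounding u to the grid θℤ gives a vector supported on 8k indices
that is nearly annihilated by all other rows, and these rows are independent on that support. A
union bound over supports and grid vectors costs exp(40kLl), while the rows give at most
exp(-pkn/4); this is where pn ≥ 300Ll is needed (`Parameters.spread_bound`). Starting from one
coordinate of size 1/n, about log n scales suffice, each losing a factor κ^7, which accounts for the
exponent in δ (`pow_le_card_of_not_hasSpreadObstruction`).

The exceptional events (huge noise, failure to spread, orthogonality to a column) have total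
probability at most 4n^(-11) ≤ n^(-10). -/

lemma gaussianReal_closedBall_le (c r : ℝ) :
    gaussianReal 0 1 (Metric.closedBall c r) ≤ ENNReal.ofReal r := by
  rw [gaussianReal_apply 0 one_ne_zero]
  have hpi : (2 : ℝ) ≤ √(2 * Real.pi) := by
    apply Real.le_sqrt_of_sq_le
    nlinarith [Real.pi_gt_three]
  -- The density bound 1/2 cancels the interval length 2r, so no constant is carried along.
  have hpdf : ∀ x, gaussianPDF 0 1 x ≤ ENNReal.ofReal (1 / 2) := by
    intro x
    apply ENNReal.ofReal_le_ofReal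
    rw [gaussianPDFReal_def]
    simp only [NNReal.coe_one, mul_one, sub_zero]
    have h1 : Real.exp (-x ^ 2 / 2) ≤ 1 := Real.exp_le_one_iff.2 (by nlinarith [sq_nonneg x])
    have h2 : (√(2 * Real.pi))⁻¹ ≤ 1 / 2 := by
      rw [one_div]; exact inv_anti₀ two_pos hpi
    calc _ ≤ (1 / 2 : ℝ) * 1 := mul_le_mul h2 h1 (Real.exp_pos _).le (by norm_num)
      _ = _ := by norm_num
  calc ∫⁻ x in Metric.closedBall c r, gaussianPDF 0 1 x
      ≤ ∫⁻ _ in Metric.closedBall c r, ENNReal.ofReal (1 / 2) := lintegral_mono fun x => hpdf x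
    _ = ENNReal.ofReal r := by
      rw [setLIntegral_const, Real.volume_closedBall, ← ENNReal.ofReal_mul (by norm_num)]
      congr 1; ring

lemma gaussianReal_abs_mul_add_le {z a d t : ℝ} (ha : 0 < a) (hz : a ≤ |z|) (ht : 0 ≤ t) :
    gaussianReal 0 1 {x | |z * x + d| ≤ t} ≤ ENNReal.ofReal (t / a) := by
  have hz0 : 0 < |z| := ha.trans_le hz
  have hz1 : z ≠ 0 := abs_pos.1 hz0
  refine (measure_mono ?_).trans (gaussianReal_closedBall_le (-d / z) (t / a))
  intro x hx
  simp only [Set.mem_ofPred_eq] at hx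
  rw [Metric.mem_closedBall, Real.dist_eq]
  have : x - -d / z = (z * x + d) / z := by field_simp; ring
  rw [this, abs_div]
  exact div_le_div₀ ht hx ha hz

instance isProbabilityMeasure_sparseGaussian {p : ℝ} [h : Fact (p ∈ Set.Icc (0 : ℝ) 1)] :
    IsProbabilityMeasure (sparseGaussian p) := by
  constructor
  simp only [sparseGaussian, Measure.coe_add, Measure.coe_smul, Pi.add_apply, Pi.smul_apply,
    measure_univ, smul_eq_mul, mul_one]
  rw [← ENNReal.ofReal_add h.out.1 (by linarith [h.out.2])]
  simp

/-! ### Small-ball estimates for sums, independence and tails -/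

section Concentration

variable {Ω : Type*} [MeasurableSpace Ω] {μ : Measure Ω} [IsProbabilityMeasure μ]

lemma measurableSet_abs_add_le (z c t : ℝ) :
    MeasurableSet {q : ℝ × ℝ | |q.1 + z * q.2 - c| ≤ t} :=
  measurableSet_le (by fun_prop) measurable_const

lemma concentration_add {X Y : Ω → ℝ} (hX : Measurable X)
    (hY : Measurable Y) (hind : IndepFun Y X μ) (z c t : ℝ) (ν : Measure ℝ)
    (hν : μ.map X = ν) :
    μ {ω | |Y ω + z * X ω - c| ≤ t} = (μ.map Y).prod ν {q : ℝ × ℝ | |q.1 + z * q.2 - c| ≤ t} := by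
  rw [← hν, ← hind.map_prod_eq_prod_map_map hY.aemeasurable hX.aemeasurable,
    Measure.map_apply (hY.prodMk hX) (measurableSet_abs_add_le z c t)]
  rfl

/-- Freezing X only moves the centre, and the bound on Y is uniform in the centre: an extra
independent summand never harms concentration. -/
lemma concentration_add_le {p : ℝ} (hp : p ∈ Set.Icc (0 : ℝ) 1) {X Y : Ω → ℝ} (hX : Measurable X)
    (hY : Measurable Y) (hind : IndepFun Y X μ) (hlaw : μ.map X = sparseGaussian p)
    (z t : ℝ) (q : ℝ≥0∞) (hq : ∀ c, μ {ω | |Y ω - c| ≤ t} ≤ q) (c : ℝ) :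
    μ {ω | |Y ω + z * X ω - c| ≤ t} ≤ q := by
  have : Fact (p ∈ Set.Icc (0 : ℝ) 1) := ⟨hp⟩
  have : IsProbabilityMeasure (μ.map Y) := Measure.isProbabilityMeasure_map hY.aemeasurable
  rw [concentration_add hX hY hind z c t _ hlaw,
    Measure.prod_apply_symm (measurableSet_abs_add_le z c t)]
  calc _ ≤ ∫⁻ _, q ∂(sparseGaussian p) := by
        refine lintegral_mono fun x => ?_
        rw [Measure.map_apply hY (measurable_prodMk_right (measurableSet_abs_add_le z c t))]
        refine le_trans (le_of_eq ?_) (hq (c - z * x))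
        congr 1; ext ω; simp only [Set.mem_preimage, Set.mem_ofPred_eq]
        rw [show Y ω + z * x - c = Y ω - (c - z * x) by ring]
    _ = q := by simp

/-- Here Y is frozen. On the Gaussian part of the law, the density bound handles every shift; on the
atom at 0 the sum is just Y, for which q is available. -/
lemma concentration_add_le_of_large {p : ℝ} (hp : p ∈ Set.Icc (0 : ℝ) 1) {X Y : Ω → ℝ}
    (hX : Measurable X)
    (hY : Measurable Y) (hind : IndepFun Y X μ) (hlaw : μ.map X = sparseGaussian p)
    {z a t : ℝ} (ha : 0 < a) (hz : a ≤ |z|) (ht : 0 ≤ t)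
    (q : ℝ≥0∞) (hq : ∀ c, μ {ω | |Y ω - c| ≤ t} ≤ q) (c : ℝ) :
    μ {ω | |Y ω + z * X ω - c| ≤ t}
      ≤ ENNReal.ofReal p * ENNReal.ofReal (t / a) + ENNReal.ofReal (1 - p) * q := by
  have : Fact (p ∈ Set.Icc (0 : ℝ) 1) := ⟨hp⟩
  have : IsProbabilityMeasure (μ.map Y) := Measure.isProbabilityMeasure_map hY.aemeasurable
  rw [concentration_add hX hY hind z c t _ hlaw,
    Measure.prod_apply (measurableSet_abs_add_le z c t)]
  have hset : MeasurableSet {y : ℝ | |y - c| ≤ t} :=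
    measurableSet_le (by fun_prop) measurable_const
  calc _ ≤ ∫⁻ y, (ENNReal.ofReal p * ENNReal.ofReal (t / a)
            + ENNReal.ofReal (1 - p) * Set.indicator {y : ℝ | |y - c| ≤ t} 1 y) ∂(μ.map Y) := by
        refine lintegral_mono fun y => ?_
        simp only [sparseGaussian, Measure.coe_add, Measure.coe_smul, Pi.add_apply, Pi.smul_apply,
          smul_eq_mul]
        gcongr
        · refine le_trans (le_of_eq ?_) (gaussianReal_abs_mul_add_le (d := y - c) ha hz ht)
          congr 1; ext x; simp only [Set.mem_preimage, Set.mem_ofPred_eq]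
          rw [show y + z * x - c = z * x + (y - c) by ring]
        · rw [Measure.dirac_apply' _ (measurable_prodMk_left (measurableSet_abs_add_le z c t))]
          refine le_of_eq ?_
          simp [Set.indicator_apply]
    _ = ENNReal.ofReal p * ENNReal.ofReal (t / a)
          + ENNReal.ofReal (1 - p) * μ {ω | |Y ω - c| ≤ t} := by
        rw [lintegral_add_left measurable_const, lintegral_const_mul _
          (measurable_one.indicator hset), lintegral_indicator_one hset,
          Measure.map_apply hY hset]
        simp
    _ ≤ _ := by gcongr; exact hq c

/-- Small-ball estimate for a linear combination of independent sparse Gaussians. -/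
lemma concentration_sum_le {ι : Type*} [DecidableEq ι] {p : ℝ} (hp : p ∈ Set.Icc (0 : ℝ) 1)
    {X : ι → Ω → ℝ} (hX : ∀ i, Measurable (X i)) (hind : iIndepFun X μ)
    (hlaw : ∀ i, μ.map (X i) = sparseGaussian p) (z : ι → ℝ) {a t : ℝ} (ha : 0 < a) (ht : 0 ≤ t)
    (J : Finset ι) (c : ℝ) :
    μ {ω | |∑ j ∈ J, z j * X j ω - c| ≤ t}
      ≤ ENNReal.ofReal ((1 - p) ^ (J.filter fun j => a ≤ |z j|).card + t / a) := by
  induction J using Finset.induction_on generalizing c with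
  | empty =>
    refine prob_le_one.trans ?_
    simp only [Finset.filter_empty, Finset.card_empty, pow_zero]
    rw [← ENNReal.ofReal_one]
    apply ENNReal.ofReal_le_ofReal
    have : 0 ≤ t / a := by positivity
    linarith
  | insert i J hi ih =>
    have hY : Measurable fun ω => ∑ j ∈ J, z j * X j ω :=
      Finset.measurable_fun_sum _ fun j _ => (hX j).const_mul _
    have hI : IndepFun (fun ω => ∑ j ∈ J, z j * X j ω) (X i) μ := by
      have h := hind.indepFun_finset J {i} (by simpa using hi) hX
      have hψ : Measurable fun x : ({i} : Finset ι) → ℝ => x ⟨i, by simp⟩ := measurable_pi_apply _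
      have hφ : Measurable fun x : J → ℝ => ∑ j : J, z j * x j :=
        Finset.measurable_fun_sum _ fun j _ => (measurable_pi_apply j).const_mul _
      have := h.comp hφ hψ
      convert this using 1
      · ext ω
        simp only [Function.comp_apply]
        rw [Finset.sum_coe_sort J (fun j => z j * X j ω)]
      · rfl
    have hrw : ∀ ω, ∑ j ∈ insert i J, z j * X j ω = ∑ j ∈ J, z j * X j ω + z i * X i ω := by
      intro ω; rw [Finset.sum_insert hi, add_comm]
    simp only [hrw]
    rw [Finset.filter_insert]
    split_ifs with h
    · refine (concentration_add_le_of_large hp (hX i) hY hI (hlaw i) ha h ht _ ih c).trans ?_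
      rw [Finset.card_insert_of_notMem (by simp [hi])]
      have h1 : 0 ≤ 1 - p := by linarith [hp.2]
      have h2 : 0 ≤ t / a := by positivity
      have hp0 := hp.1
      rw [← ENNReal.ofReal_mul hp.1, ← ENNReal.ofReal_mul h1, ← ENNReal.ofReal_add (by positivity)
        (by positivity)]
      -- The recursion q ↦ p(t/a) + (1 - p)q has fixed point t/a, so the error terms do not
      -- accumulate and only the excess over t/a shrinks by 1 - p.
      apply le_of_eq; congr 1; ring
    · exact concentration_add_le hp (hX i) hY hI (hlaw i) _ _ _ ih c

/-- Linear forms in disjoint groups of independent variables are jointly concentrated with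
probability at most the product of the individual bounds. -/
lemma concentration_forall_le {ι κ σ : Type*} [DecidableEq ι] [DecidableEq κ] [DecidableEq σ]
    {X : ι → Ω → ℝ} (hX : ∀ i, Measurable (X i)) (hind : iIndepFun X μ) (z : σ → ℝ) (t : ℝ)
    (e : κ → σ → ι) (S : Finset σ) (d : κ → ℝ) (q : ℝ≥0∞) (I : Finset κ)
    (hdisj : ∀ i ∈ I, ∀ i' ∈ I, i ≠ i' → ∀ j ∈ S, ∀ j' ∈ S, e i j ≠ e i' j')
    (hq : ∀ i ∈ I, μ {ω | |∑ j ∈ S, z j * X (e i j) ω - d i| ≤ t} ≤ q) :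
    μ {ω | ∀ i ∈ I, |∑ j ∈ S, z j * X (e i j) ω - d i| ≤ t} ≤ q ^ I.card := by
  induction I using Finset.induction_on with
  | empty => simp
  | insert i I hi ih =>
    have ih' := ih (fun a ha b hb => hdisj a (Finset.mem_insert_of_mem ha) b
      (Finset.mem_insert_of_mem hb)) (fun a ha => hq a (Finset.mem_insert_of_mem ha))
    let J : Finset ι := S.image (e i)
    let K : Finset ι := I.biUnion fun i' => S.image (e i')
    have hJK : Disjoint J K := by
      rw [Finset.disjoint_left]
      intro x hx hx'
      simp only [J, K, Finset.mem_image, Finset.mem_biUnion] at hx hx'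
      obtain ⟨j, hj, rfl⟩ := hx
      obtain ⟨i', hi', j', hj', h⟩ := hx'
      exact hdisj i (Finset.mem_insert_self _ _) i' (Finset.mem_insert_of_mem hi')
        (fun h => hi (h ▸ hi')) j hj j' hj' h.symm
    have h := hind.indepFun_finset J K hJK hX
    let A : Set (J → ℝ) := {x | |∑ j : S, z j * x ⟨e i j, Finset.mem_image_of_mem _ j.2⟩ - d i| ≤ t}
    have hA : MeasurableSet A := by
      refine measurableSet_le (Measurable.abs (Measurable.sub_const ?_ _)) measurable_const
      exact Finset.measurable_fun_sum _ fun j _ => (measurable_pi_apply _).const_mul _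
    let B : Set (K → ℝ) := ⋂ i' : I, {x | |∑ j : S, z j * x ⟨e i' j,
      Finset.mem_biUnion.2 ⟨i', i'.2, Finset.mem_image_of_mem _ j.2⟩⟩ - d i'| ≤ t}
    have hB : MeasurableSet B := by
      refine MeasurableSet.iInter fun i' => ?_
      refine measurableSet_le (Measurable.abs (Measurable.sub_const ?_ _)) measurable_const
      exact Finset.measurable_fun_sum _ fun j _ => (measurable_pi_apply _).const_mul _
    have hAB := h.measure_inter_preimage_eq_mul A B hA hB
    have hA' : (fun a (i : J) => X i a) ⁻¹' A
        = {ω | |∑ j ∈ S, z j * X (e i j) ω - d i| ≤ t} := by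
      ext ω
      simp only [A, Set.mem_preimage, Set.mem_ofPred_eq]
      rw [Finset.sum_coe_sort S (fun j => z j * X (e i j) ω)]
    have hB' : (fun a (i : K) => X i a) ⁻¹' B
        = {ω | ∀ i ∈ I, |∑ j ∈ S, z j * X (e i j) ω - d i| ≤ t} := by
      ext ω
      simp only [B, Set.mem_preimage, Set.mem_ofPred_eq, Set.mem_iInter, Subtype.forall]
      refine forall₂_congr fun i' _ => ?_
      rw [Finset.sum_coe_sort S (fun j => z j * X (e i' j) ω)]
    rw [hA', hB'] at hAB
    have hset : {ω | ∀ i' ∈ insert i I, |∑ j ∈ S, z j * X (e i' j) ω - d i'| ≤ t}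
        = {ω | |∑ j ∈ S, z j * X (e i j) ω - d i| ≤ t} ∩
          {ω | ∀ i ∈ I, |∑ j ∈ S, z j * X (e i j) ω - d i| ≤ t} := by
      ext ω; simp
    rw [hset, hAB, Finset.card_insert_of_notMem hi, pow_succ']
    exact mul_le_mul' (hq i (Finset.mem_insert_self _ _)) ih'

/-- A bound on the probability of a family of events that holds for every fixed parameter also
holds for a random parameter with countably many values independent of the events. -/
lemma measure_mem_le_of_indepFun {α β : Type*} [MeasurableSpace α] [Countable α]
    [MeasurableSingletonClass α] [MeasurableSpace β] {Z : Ω → α} {W : Ω → β}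
    (hZ : Measurable Z) (hind : IndepFun Z W μ) (B : α → Set β)
    (hB : ∀ a, MeasurableSet (B a)) (q : ℝ≥0∞) (hq : ∀ a, μ (W ⁻¹' B a) ≤ q) :
    μ {ω | W ω ∈ B (Z ω)} ≤ q := by
  -- Splitting over the countably many values of Z avoids any joint measurability of `B`.
  have hsub : {ω | W ω ∈ B (Z ω)} ⊆ ⋃ a, Z ⁻¹' {a} ∩ W ⁻¹' B a := by
    intro ω hω
    exact Set.mem_iUnion.2 ⟨Z ω, rfl, hω⟩
  calc μ {ω | W ω ∈ B (Z ω)} ≤ ∑' a, μ (Z ⁻¹' {a} ∩ W ⁻¹' B a) :=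
        (measure_mono hsub).trans (measure_iUnion_le _)
    _ ≤ ∑' a, μ (Z ⁻¹' {a}) * q := by
        refine ENNReal.tsum_le_tsum fun a => ?_
        rw [hind.measure_inter_preimage_eq_mul _ _ (measurableSet_singleton a) (hB a)]
        gcongr; exact hq a
    _ = q := by
        rw [ENNReal.tsum_mul_right, ← measure_iUnion (fun a b hab => ?_)
          (fun a => hZ (measurableSet_singleton a))]
        · rw [← Set.preimage_iUnion, Set.iUnion_of_singleton]; simp
        · exact Disjoint.preimage _ (by simpa using hab)

lemma gaussianReal_abs_gt_le {B : ℝ} (hB : 0 ≤ B) :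
    gaussianReal 0 1 {x | B < |x|} ≤ ENNReal.ofReal (2 * Real.exp (-B ^ 2 / 2)) := by
  have h1 : HasSubgaussianMGF id 1 (gaussianReal 0 1) :=
    { integrable_exp_mul := fun t => by
        simpa using integrable_exp_mul_gaussianReal (μ := 0) (v := 1) t
      mgf_le := fun t => by simp [mgf_id_gaussianReal] }
  have key : ∀ {Y : ℝ → ℝ}, HasSubgaussianMGF Y 1 (gaussianReal 0 1) →
      gaussianReal 0 1 {x | B ≤ Y x} ≤ ENNReal.ofReal (Real.exp (-B ^ 2 / 2)) := by
    intro Y hY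
    have := hY.measure_ge_le hB
    rw [← ofReal_measureReal]
    apply ENNReal.ofReal_le_ofReal
    simpa using this
  have hsub : {x : ℝ | B < |x|} ⊆ {x | B ≤ id x} ∪ {x | B ≤ (-id) x} := by
    intro x hx
    rcases lt_abs.1 (show B < |x| from hx) with h | h
    · exact Or.inl h.le
    · exact Or.inr h.le
  refine (measure_mono hsub).trans ((measure_union_le _ _).trans ?_)
  rw [two_mul, ENNReal.ofReal_add (Real.exp_pos _).le (Real.exp_pos _).le]
  exact add_le_add (key h1) (key h1.neg)

lemma sparseGaussian_abs_gt_le {p : ℝ} (hp1 : p ≤ 1) {B : ℝ} (hB : 0 ≤ B) :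
    sparseGaussian p {x | B < |x|} ≤ ENNReal.ofReal (2 * Real.exp (-B ^ 2 / 2)) := by
  have hm : MeasurableSet {x : ℝ | B < |x|} := measurableSet_lt measurable_const (by fun_prop)
  simp only [sparseGaussian, Measure.coe_add, Measure.coe_smul, Pi.add_apply, Pi.smul_apply,
    smul_eq_mul]
  rw [Measure.dirac_apply' _ hm, Set.indicator_of_notMem (by simpa using hB), mul_zero, add_zero]
  calc _ ≤ 1 * gaussianReal 0 1 {x | B < |x|} := by
        gcongr; exact ENNReal.ofReal_le_one.2 hp1
    _ ≤ _ := by rw [one_mul]; exact gaussianReal_abs_gt_le hB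

end Concentration

/-! ### Eigenvectors, rounding and close eigenvalues -/

section LinearAlgebra

open Matrix

/-- Testing positivity on e_i + e_j gives 2A_ij ≥ -A_ii - A_jj, which supplies the missing lower
bound. -/
lemma abs_apply_le_of_posDef {n : ℕ} {A : Matrix (Fin n) (Fin n) ℝ} (hA : A.PosDef) {b : ℝ}
    (hb : ∀ i j, A i j ≤ b) (i j : Fin n) : |A i j| ≤ b := by
  refine abs_le.2 ⟨?_, hb i j⟩
  have hsymm : A j i = A i j := by simpa using hA.isHermitian.apply i j
  have h := hA.posSemidef.dotProduct_mulVec_nonneg (Pi.single i 1 + Pi.single j 1)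
  simp [Matrix.mulVec_add, add_dotProduct, dotProduct_add, hsymm] at h
  have h1 := hb i i
  have h2 := hb j j
  linarith

lemma isHermitian_perturb {n : ℕ} {Abar : Matrix (Fin n) (Fin n) ℝ} (hA : Abar.IsHermitian) (κ : ℝ)
    (x : Sym2 (Fin n) → ℝ) : (perturb Abar κ x).IsHermitian := by
  ext i j
  have : Abar j i = Abar i j := by simpa using hA.apply i j
  simp [perturb, this, Sym2.eq_swap]

/-- Noise of size nκ becomes 1/n after scaling, the same size as the entries of `Abar`. The
resulting row bound confines the spectrum to [-2, 2]. -/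
lemma sum_abs_perturb_le {n : ℕ} (hn : 0 < n) {Abar : Matrix (Fin n) (Fin n) ℝ} {κ : ℝ} (hκ : 0 < κ)
    (hA : ∀ i j, |Abar i j| ≤ 1 / n) {x : Sym2 (Fin n) → ℝ} (hx : ∀ e, |x e| ≤ n * κ) (i : Fin n) :
    ∑ j, |perturb Abar κ x i j| ≤ 2 := by
  have hn' : (0 : ℝ) < n := by exact_mod_cast hn
  have h : ∀ j, |perturb Abar κ x i j| ≤ 2 / n := by
    intro j
    simp only [perturb, Matrix.of_apply]
    refine (abs_add_le _ _).trans ?_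
    rw [abs_mul, abs_of_pos (by positivity : 0 < 1 / ((n : ℝ) ^ 2 * κ))]
    have h1 : 1 / ((n : ℝ) ^ 2 * κ) * |x s(i, j)| ≤ 1 / ((n : ℝ) ^ 2 * κ) * (n * κ) := by
      gcongr; exact hx _
    have h2 : 1 / ((n : ℝ) ^ 2 * κ) * (n * κ) = 1 / n := by field_simp
    have h3 : (2 : ℝ) / n = 1 / n + 1 / n := by ring
    linarith [hA i j]
  calc _ ≤ ∑ _j : Fin n, (2 : ℝ) / n := Finset.sum_le_sum fun j _ => h j
    _ = 2 := by simp; field_simp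

lemma abs_sum_mul_le {n : ℕ} (S : Finset (Fin n)) {r u : Fin n → ℝ} {b c : ℝ} (hc : 0 ≤ c)
    (hr : ∑ j, |r j| ≤ b) (hu : ∀ j ∈ S, |u j| ≤ c) : |∑ j ∈ S, r j * u j| ≤ b * c := by
  calc |∑ j ∈ S, r j * u j| ≤ ∑ j ∈ S, |r j| * c := by
        refine (Finset.abs_sum_le_sum_abs _ _).trans (Finset.sum_le_sum fun j hj => ?_)
        rw [abs_mul]; gcongr; exact hu j hj
    _ = (∑ j ∈ S, |r j|) * c := by rw [Finset.sum_mul]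
    _ ≤ (∑ j, |r j|) * c := by
        gcongr; exact Finset.subset_univ S
    _ ≤ b * c := by gcongr

/-- An approximate eigenvector supported (up to `θ`) on `S` gives, after rounding to the grid
`θ ℤ`, a vector on `S` that is almost annihilated by the rows outside `S`. -/
lemma abs_sum_round_le {n : ℕ} {A : Matrix (Fin n) (Fin n) ℝ} (hrow : ∀ i, ∑ j, |A i j| ≤ 2)
    {u : Fin n → ℝ} {ν θ : ℝ} (hθ : 0 < θ) (hν : |ν| ≤ 3) {k : Fin n}
    (heq : ∀ i, i ≠ k → |∑ j, A i j * u j - ν * u i| ≤ θ) {S : Finset (Fin n)}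
    (hS : ∀ j, j ∉ S → |u j| ≤ θ) (hk : k ∈ S) (i : Fin n) (hi : i ∉ S) :
    |∑ j ∈ S, A i j * (θ * ⌊u j / θ⌋)| ≤ 8 * θ := by
  have hround : ∀ j, |u j - θ * ⌊u j / θ⌋| ≤ θ := by
    intro j
    have h1 := Int.floor_le (u j / θ)
    have h2 := Int.lt_floor_add_one (u j / θ)
    rw [le_div_iff₀ hθ] at h1
    rw [div_lt_iff₀ hθ] at h2
    rw [abs_le]; constructor <;> nlinarith
  -- The total 8θ is 2θ from rounding on S, 2θ from coordinates off S, θ from the approximate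
  -- equation and 3θ from ν u_i.
  have e1 := abs_sum_mul_le S hθ.le (hrow i) (fun j _ => hround j)
  have e2 := abs_sum_mul_le Sᶜ hθ.le (hrow i) (fun j hj => hS j (Finset.mem_compl.1 hj))
  have e3 := heq i (fun h => hi (h ▸ hk))
  have e4 : |ν * u i| ≤ 3 * θ := by
    rw [abs_mul]; exact mul_le_mul hν (hS i hi) (abs_nonneg _) (by norm_num)
  have hsum := Finset.sum_add_sum_compl S (fun j => A i j * u j)
  have hid : ∑ j ∈ S, A i j * (θ * ⌊u j / θ⌋)
      = (∑ j, A i j * u j - ν * u i) + ν * u i - ∑ j ∈ Sᶜ, A i j * u j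
        - ∑ j ∈ S, A i j * (u j - θ * ⌊u j / θ⌋) := by
    simp only [mul_sub, Finset.sum_sub_distrib] at *
    linarith
  rw [hid]
  rw [abs_le] at *
  constructor <;> linarith [e1.1, e1.2, e2.1, e2.2, e3.1, e3.2, e4.1, e4.2]

section Eigen

variable {n : ℕ} {A : Matrix (Fin n) (Fin n) ℝ}

lemma sum_mul_eigenvectorBasis (hA : A.IsHermitian) (l i : Fin n) :
    ∑ j, A i j * hA.eigenvectorBasis l j = hA.eigenvalues l * hA.eigenvectorBasis l i := by
  have := congrFun (hA.mulVec_eigenvectorBasis l) i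
  simpa [Matrix.mulVec, dotProduct] using this

lemma sum_sq_eigenvectorBasis (hA : A.IsHermitian) (l : Fin n) :
    ∑ j, hA.eigenvectorBasis l j ^ 2 = 1 := by
  have h := hA.eigenvectorBasis.orthonormal.1 l
  rw [EuclideanSpace.norm_eq, Real.sqrt_eq_one] at h
  simpa using h

lemma sum_mul_eigenvectorBasis_eq_zero (hA : A.IsHermitian) {l m : Fin n} (h : l ≠ m) :
    ∑ j, hA.eigenvectorBasis l j * hA.eigenvectorBasis m j = 0 := by
  have h := hA.eigenvectorBasis.orthonormal.2 h
  simpa [PiLp.inner_apply, mul_comm] using h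

lemma abs_eigenvectorBasis_le_one (hA : A.IsHermitian) (l j : Fin n) :
    |hA.eigenvectorBasis l j| ≤ 1 := by
  rw [← sq_le_one_iff_abs_le_one, ← sum_sq_eigenvectorBasis hA l]
  exact Finset.single_le_sum (f := fun j => hA.eigenvectorBasis l j ^ 2)
    (fun i _ => sq_nonneg _) (Finset.mem_univ j)

lemma exists_inv_le_abs_eigenvectorBasis (hA : A.IsHermitian) (l : Fin n) :
    ∃ k, 1 / (n : ℝ) ≤ |hA.eigenvectorBasis l k| := by
  by_contra! h
  have hn : 0 < n := Fin.pos l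
  have hn' : (1 : ℝ) ≤ n := by exact_mod_cast hn
  have h1 := sum_sq_eigenvectorBasis hA l
  have h2 : ∑ j, hA.eigenvectorBasis l j ^ 2 < ∑ _j : Fin n, (1 : ℝ) / n := by
    refine Finset.sum_lt_sum_of_nonempty ⟨l, Finset.mem_univ l⟩ fun j _ => ?_
    rw [← sq_abs]
    have h3 := abs_eigenvectorBasis_le_one hA l j
    nlinarith [h j, abs_nonneg (hA.eigenvectorBasis l j)]
  rw [h1] at h2
  simp at h2
  rw [mul_inv_cancel₀ (by positivity)] at h2
  exact lt_irrefl _ h2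

/-- A symmetric matrix has an eigenvalue within `c` of `lam` as soon as some vector is an
approximate eigenvector for `lam` with relative error `c`. -/
lemma exists_eigenvalue_near (hA : A.IsHermitian) {w : Fin n → ℝ} {lam c : ℝ} (hc : 0 ≤ c)
    (hw : 0 < ∑ j, w j ^ 2)
    (h : ∑ i, (∑ j, A i j * w j - lam * w i) ^ 2 ≤ c ^ 2 * ∑ j, w j ^ 2) :
    ∃ l, |hA.eigenvalues l - lam| ≤ c := by
  by_contra! hcon
  -- In the eigenbasis, A - lam multiplies each coefficient of w by the distance of an eigenvalue to
  -- lam; if all distances exceeded c, the residual would be too large.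
  have parseval : ∀ x : Fin n → ℝ,
      ∑ l, (∑ j, hA.eigenvectorBasis l j * x j) ^ 2 = ∑ j, x j ^ 2 := by
    intro x
    have := hA.eigenvectorBasis.sum_sq_norm_inner_right (WithLp.toLp 2 x)
    rw [EuclideanSpace.norm_sq_eq] at this
    simpa [PiLp.inner_apply, mul_comm] using this
  rw [← parseval w] at h hw
  rw [← parseval] at h
  have key : ∀ l, ∑ j, hA.eigenvectorBasis l j * (∑ j', A j j' * w j' - lam * w j)
      = (hA.eigenvalues l - lam) * ∑ j, hA.eigenvectorBasis l j * w j := by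
    intro l
    have hs : ∑ j, hA.eigenvectorBasis l j * ∑ j', A j j' * w j'
        = ∑ j, hA.eigenvalues l * hA.eigenvectorBasis l j * w j := by
      simp only [Finset.mul_sum]
      rw [Finset.sum_comm]
      refine Finset.sum_congr rfl fun j _ => ?_
      rw [← sum_mul_eigenvectorBasis hA l j, Finset.sum_mul]
      refine Finset.sum_congr rfl fun i _ => ?_
      have : A i j = A j i := by simpa using hA.apply j i
      rw [this]; ring
    simp only [mul_sub, Finset.sum_sub_distrib, hs, sub_mul]
    simp only [Finset.mul_sum]
    congr 1 <;> exact Finset.sum_congr rfl fun j _ => by ring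
  simp only [key, mul_pow] at h
  rw [Finset.mul_sum] at h
  have hlt : ∀ l, c ^ 2 < (hA.eigenvalues l - lam) ^ 2 := by
    intro l
    rw [← sq_abs (hA.eigenvalues l - lam)]
    have := hcon l
    nlinarith
  obtain ⟨l, -, hl⟩ := Finset.exists_lt_of_sum_lt (s := Finset.univ) (f := fun _ => (0 : ℝ))
    (by simpa using hw)
  refine absurd h (not_le.2 (Finset.sum_lt_sum (fun l _ => ?_) ⟨l, Finset.mem_univ l, ?_⟩))
  · exact mul_le_mul_of_nonneg_right (hlt l).le (sq_nonneg _)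
  · exact mul_lt_mul_of_pos_right (hlt l) hl

lemma abs_eigenvalues_le (hA : A.IsHermitian) {b : ℝ} (hb : ∀ i, ∑ j, |A i j| ≤ b) (l : Fin n) :
    |hA.eigenvalues l| ≤ b := by
  obtain ⟨k, -, hk⟩ := Finset.exists_max_image Finset.univ
    (fun j => |hA.eigenvectorBasis l j|) ⟨l, Finset.mem_univ l⟩
  obtain ⟨k', hk'⟩ := exists_inv_le_abs_eigenvectorBasis hA l
  have hn : (0 : ℝ) < n := by exact_mod_cast Fin.pos l
  have hpos : 0 < |hA.eigenvectorBasis l k| :=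
    lt_of_lt_of_le (by positivity) (hk'.trans (hk k' (Finset.mem_univ _)))
  have h := abs_sum_mul_le Finset.univ hpos.le (hb k) hk
  rw [sum_mul_eigenvectorBasis, abs_mul] at h
  exact le_of_mul_le_mul_right h hpos

/-- If two eigenvalues of `A` are `δ`-close then some `δ`-approximation of a principal minor of `A`
has an eigenvector almost orthogonal to the removed column. The removed index is kept as an
isolated coordinate with diagonal entry `10`. -/
lemma exists_minor_eigenvector (hA : A.IsHermitian) (hrow : ∀ i, ∑ j, |A i j| ≤ 2) {δ : ℝ}
    (hδ : 0 ≤ δ) (hδ1 : 2 * (n : ℝ) ^ 2 * δ ≤ 1) {a b : Fin n} (hab : a ≠ b)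
    (hgap : |hA.eigenvalues a - hA.eigenvalues b| ≤ δ)
    {M : Fin n → Matrix (Fin n) (Fin n) ℝ} (hM : ∀ k, (M k).IsHermitian)
    (hdiag : ∀ k, M k k k = 10) (hoff : ∀ k j, j ≠ k → M k k j = 0)
    (hclose : ∀ k i j, i ≠ k → j ≠ k → |A i j - M k i j| ≤ δ) :
    ∃ k l, |(hM k).eigenvalues l| ≤ 3 ∧ (hM k).eigenvectorBasis l k = 0 ∧
      (∀ i, i ≠ k → |∑ j, A i j * (hM k).eigenvectorBasis l j
        - (hM k).eigenvalues l * (hM k).eigenvectorBasis l i| ≤ n * δ) ∧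
      |∑ j, A k j * (hM k).eigenvectorBasis l j| ≤ 4 * (n : ℝ) ^ 4 * δ := by
  have hn : 0 < n := Fin.pos a
  have hn1 : (1 : ℝ) ≤ n := by exact_mod_cast hn
  obtain ⟨k, hk⟩ := exists_inv_le_abs_eigenvectorBasis hA a
  set v : Fin n → ℝ := fun j => hA.eigenvectorBasis a j with hv
  set v' : Fin n → ℝ := fun j => hA.eigenvectorBasis b j with hv'
  set lam := hA.eigenvalues a with hlam
  set lam' := hA.eigenvalues b with hlam'
  have hAv : ∀ i, ∑ j, A i j * v j = lam * v i := sum_mul_eigenvectorBasis hA a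
  have hAv' : ∀ i, ∑ j, A i j * v' j = lam' * v' i := sum_mul_eigenvectorBasis hA b
  have hvv : ∑ j, v j ^ 2 = 1 := sum_sq_eigenvectorBasis hA a
  have hvv' : ∑ j, v' j ^ 2 = 1 := sum_sq_eigenvectorBasis hA b
  have horth : ∑ j, v j * v' j = 0 := sum_mul_eigenvectorBasis_eq_zero hA hab
  have hv1 : ∀ j, |v j| ≤ 1 := abs_eigenvectorBasis_le_one hA a
  have hv1' : ∀ j, |v' j| ≤ 1 := abs_eigenvectorBasis_le_one hA b
  have hvk : 0 < |v k| := lt_of_lt_of_le (by positivity) hk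
  -- By orthonormality ‖w‖² = v_k² + v'_k², so |v_k| ≤ ‖w‖ and the residual stays small relative to
  -- ‖w‖.
  let w : Fin n → ℝ := fun j => v' k * v j - v k * v' j
  have hwk : w k = 0 := by simp only [w]; ring
  have hwsq : ∑ j, w j ^ 2 = v k ^ 2 + v' k ^ 2 := by
    have : ∀ j, w j ^ 2 = v' k ^ 2 * v j ^ 2 - 2 * v k * v' k * (v j * v' j) + v k ^ 2 * v' j ^ 2 :=
      fun j => by simp only [w]; ring
    simp only [this, Finset.sum_add_distrib, Finset.sum_sub_distrib, ← Finset.mul_sum, hvv, hvv',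
      horth]
    ring
  have hwpos : 0 < ∑ j, w j ^ 2 := by
    rw [hwsq]
    have := sq_pos_of_pos hvk
    rw [sq_abs] at this
    positivity
  set σ := √(∑ j, w j ^ 2) with hσ
  have hσsq : σ ^ 2 = ∑ j, w j ^ 2 := Real.sq_sqrt hwpos.le
  have hσ0 : 0 ≤ σ := Real.sqrt_nonneg _
  have hwσ : ∀ j, |w j| ≤ σ := fun j => by
    refine abs_le_of_sq_le_sq ?_ hσ0
    rw [hσsq]
    exact Finset.single_le_sum (f := fun j => w j ^ 2) (fun i _ => sq_nonneg _) (Finset.mem_univ j)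
  have hvkσ : |v k| ≤ σ := by
    refine abs_le_of_sq_le_sq ?_ hσ0
    rw [hσsq, hwsq]; nlinarith [sq_nonneg (v' k)]
  have hAw : ∀ i, ∑ j, A i j * w j - lam * w i = v k * ((lam - lam') * v' i) := by
    intro i
    have : ∑ j, A i j * w j = v' k * ∑ j, A i j * v j - v k * ∑ j, A i j * v' j := by
      rw [Finset.mul_sum, Finset.mul_sum, ← Finset.sum_sub_distrib]
      exact Finset.sum_congr rfl fun j _ => by simp only [w]; ring
    rw [this, hAv, hAv']; simp only [w]; ring
  have hMw : ∀ i, |∑ j, M k i j * w j - lam * w i| ≤ 2 * n * δ * σ := by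
    intro i
    by_cases hi : i = k
    · subst hi
      have : ∑ j, M i i j * w j = 0 := by
        refine Finset.sum_eq_zero fun j _ => ?_
        by_cases hj : j = i
        · rw [hj, hwk, mul_zero]
        · rw [hoff i j hj, zero_mul]
      rw [this, hwk]; simp; positivity
    · have e1 : |∑ j, (A i j - M k i j) * w j| ≤ n * (δ * σ) := by
        calc _ ≤ ∑ j, |(A i j - M k i j) * w j| := Finset.abs_sum_le_sum_abs _ _
          _ ≤ ∑ _j : Fin n, δ * σ := by
            refine Finset.sum_le_sum fun j _ => ?_
            by_cases hj : j = k
            · rw [hj, hwk]; simp; positivity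
            · rw [abs_mul]
              exact mul_le_mul (hclose k i j hi hj) (hwσ j) (abs_nonneg _) hδ
          _ = n * (δ * σ) := by simp
      have e2 : |v k * ((lam - lam') * v' i)| ≤ δ * σ := by
        rw [abs_mul, abs_mul]
        calc |v k| * (|lam - lam'| * |v' i|) ≤ σ * (δ * 1) := by
              gcongr; exact hv1' i
          _ = δ * σ := by ring
      rw [← hAw i] at e2
      have e3 : ∑ j, M k i j * w j - lam * w i
          = (∑ j, A i j * w j - lam * w i) - ∑ j, (A i j - M k i j) * w j := by
        simp only [sub_mul, Finset.sum_sub_distrib]; ring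
      rw [e3]
      refine (abs_sub _ _).trans ?_
      have : δ * σ ≤ n * (δ * σ) := le_mul_of_one_le_left (by positivity) hn1
      linarith
  -- Each coordinate of the residual is at most 2nδσ; summing squares over n coordinates costs √n,
  -- bounded here by n.
  obtain ⟨l, hl⟩ := exists_eigenvalue_near (hM k) (w := w) (lam := lam)
    (c := 2 * (n : ℝ) ^ 2 * δ) (by positivity) hwpos (by
      rw [← hσsq]
      calc _ ≤ ∑ _i : Fin n, (2 * n * δ * σ) ^ 2 := by
            refine Finset.sum_le_sum fun i _ => ?_
            rw [← sq_abs]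
            have := hMw i
            gcongr
        _ = (n : ℝ) * (2 * n * δ * σ) ^ 2 := by simp
        _ ≤ (n : ℝ) ^ 2 * (2 * n * δ * σ) ^ 2 := by
            gcongr; exact le_self_pow₀ hn1 two_ne_zero
        _ = _ := by ring)
  set u : Fin n → ℝ := fun j => (hM k).eigenvectorBasis l j with hu
  set ν := (hM k).eigenvalues l with hν
  have hMu : ∀ i, ∑ j, M k i j * u j = ν * u i := sum_mul_eigenvectorBasis (hM k) l
  have hu1 : ∀ j, |u j| ≤ 1 := abs_eigenvectorBasis_le_one (hM k) l
  have hlam2 : |lam| ≤ 2 := abs_eigenvalues_le hA hrow a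
  have hν3 : |ν| ≤ 3 := by
    rw [abs_le] at *
    constructor <;> linarith [hl.1, hl.2, hlam2.1, hlam2.2]
  -- The artificial diagonal entry 10 lies outside |ν| ≤ 3, so this eigenvector cannot involve the
  -- isolated coordinate.
  have huk : u k = 0 := by
    have h1 := hMu k
    rw [Finset.sum_eq_single k (fun j _ hj => by rw [hoff k j hj, zero_mul]) (by simp),
      hdiag k] at h1
    have : (10 - ν) * u k = 0 := by linarith
    rcases mul_eq_zero.1 this with h | h
    · have := (abs_le.1 hν3).2; linarith
    · exact h
  have hAu : ∀ i, i ≠ k → |∑ j, A i j * u j - ν * u i| ≤ n * δ := by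
    intro i hi
    rw [← hMu i, ← Finset.sum_sub_distrib]
    calc _ ≤ ∑ j, |A i j * u j - M k i j * u j| := Finset.abs_sum_le_sum_abs _ _
      _ ≤ ∑ _j : Fin n, δ := by
        refine Finset.sum_le_sum fun j _ => ?_
        by_cases hj : j = k
        · rw [hj, huk]; simpa using hδ
        · rw [← sub_mul, abs_mul]
          calc _ ≤ δ * 1 := mul_le_mul (hclose k i j hi hj) (hu1 j) (abs_nonneg _) hδ
            _ = δ := mul_one δ
      _ = n * δ := by simp
  refine ⟨k, l, hν3, huk, hAu, ?_⟩
  -- By symmetry A - lam moves onto v, where it vanishes. Isolating the term j = k leaves v_k times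
  -- the wanted product, and |v_k| ≥ 1/n costs a last factor n.
  have hdual : ∑ j, v j * (∑ j', A j j' * u j' - lam * u j) = 0 := by
    have h1 : ∑ j, v j * ∑ j', A j j' * u j' = ∑ j, lam * v j * u j := by
      simp only [Finset.mul_sum]
      rw [Finset.sum_comm]
      refine Finset.sum_congr rfl fun j _ => ?_
      rw [← hAv j, Finset.sum_mul]
      refine Finset.sum_congr rfl fun i _ => ?_
      have : A i j = A j i := by simpa using hA.apply j i
      rw [this]; ring
    simp only [mul_sub, Finset.sum_sub_distrib, h1]
    rw [← Finset.sum_sub_distrib]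
    exact Finset.sum_eq_zero fun j _ => by ring
  rw [← Finset.add_sum_erase _ _ (Finset.mem_univ k), huk, mul_zero, sub_zero] at hdual
  have hrest : |∑ j ∈ Finset.univ.erase k, v j * (∑ j', A j j' * u j' - lam * u j)|
      ≤ n * (3 * (n : ℝ) ^ 2 * δ) := by
    calc _ ≤ ∑ j ∈ Finset.univ.erase k, |v j * (∑ j', A j j' * u j' - lam * u j)| :=
          Finset.abs_sum_le_sum_abs _ _
      _ ≤ ∑ _j ∈ Finset.univ.erase k, (3 * (n : ℝ) ^ 2 * δ) := by
          refine Finset.sum_le_sum fun j hj => ?_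
          rw [abs_mul]
          have e1 := hAu j (Finset.ne_of_mem_erase hj)
          have e2 : |(ν - lam) * u j| ≤ 2 * (n : ℝ) ^ 2 * δ * 1 := by
            rw [abs_mul]; exact mul_le_mul hl (hu1 j) (abs_nonneg _) (by positivity)
          have e3 : ∑ j', A j j' * u j' - lam * u j
            = (∑ j', A j j' * u j' - ν * u j) + (ν - lam) * u j := by ring
          have e4 : (n : ℝ) * δ ≤ (n : ℝ) ^ 2 * δ := by
            gcongr; exact le_self_pow₀ hn1 two_ne_zero
          have e5 : |∑ j', A j j' * u j' - lam * u j| ≤ 3 * (n : ℝ) ^ 2 * δ := by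
            rw [e3]; refine (abs_add_le _ _).trans ?_; linarith
          calc _ ≤ 1 * (3 * (n : ℝ) ^ 2 * δ) := mul_le_mul (hv1 j) e5 (abs_nonneg _) zero_le_one
            _ = _ := one_mul _
      _ ≤ ∑ _j : Fin n, (3 * (n : ℝ) ^ 2 * δ) :=
          Finset.sum_le_sum_of_subset_of_nonneg (Finset.subset_univ _)
            fun _ _ _ => by positivity
      _ = n * (3 * (n : ℝ) ^ 2 * δ) := by simp
  have h5 : |v k| * |∑ j, A k j * u j| ≤ n * (3 * (n : ℝ) ^ 2 * δ) := by
    rw [← abs_mul, eq_neg_of_add_eq_zero_left hdual, abs_neg]; exact hrest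
  have h6 : 1 / (n : ℝ) * |∑ j, A k j * u j| ≤ n * (3 * (n : ℝ) ^ 2 * δ) :=
    le_trans (by gcongr) h5
  rw [one_div, inv_mul_le_iff₀ (by positivity)] at h6
  refine h6.trans ?_
  have : 0 ≤ (n : ℝ) ^ 4 * δ := by positivity
  nlinarith

end Eigen

end LinearAlgebra

/-! ### Spreading of approximate eigenvectors, scale by scale -/

/-- `S` and `z` witness that the integer vector `z`, scaled by `θ`, has at least `k` coordinates of
size `a / 2` in the `8 k`-element set `S` and is almost annihilated by the rows of `A` outside
`S`. -/
def IsSpreadObstruction {n : ℕ} (A : Matrix (Fin n) (Fin n) ℝ) (θ a : ℝ) (k : ℕ)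
    (S : Finset (Fin n)) (z : Fin n → ℤ) : Prop :=
  k ≤ (S.filter fun j => a / 2 ≤ |θ * (z j : ℝ)|).card ∧
    ∀ i ∈ Sᶜ, |∑ j ∈ S, A i j * (θ * (z j : ℝ))| ≤ 8 * θ

/-- There is an obstruction to spreading with `8 k`-element support and entries at most `N`. -/
def HasSpreadObstruction {n : ℕ} (A : Matrix (Fin n) (Fin n) ℝ) (θ a : ℝ) (k N : ℕ) : Prop :=
  ∃ S : Finset (Fin n), S.card = 8 * k ∧ ∃ z : Fin n → ℤ, (∀ j, |z j| ≤ N) ∧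
    IsSpreadObstruction A θ a k S z

lemma card_le_of_not_hasSpreadObstruction {n : ℕ} {A : Matrix (Fin n) (Fin n) ℝ} {θ a : ℝ}
    {k N : ℕ} (hA : ¬ HasSpreadObstruction A θ a k N) (hrow : ∀ i, ∑ j, |A i j| ≤ 2)
    (hθ : 0 < θ) (hθa : θ ≤ a / 2) (hN : 1 / θ + 1 ≤ N) (hk : 8 * k ≤ n)
    {u : Fin n → ℝ} (hu : ∀ j, |u j| ≤ 1) {ν : ℝ} (hν : |ν| ≤ 3) (r : Fin n)
    (heq : ∀ i, i ≠ r → |∑ j, A i j * u j - ν * u i| ≤ θ)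
    (hcard : k ≤ (Finset.univ.filter fun j => a ≤ |u j|).card) :
    8 * k ≤ (Finset.univ.filter fun j => θ ≤ |u j|).card := by
  by_contra! hlt
  set L := Finset.univ.filter fun j => θ ≤ |u j| with hL
  -- The equation is not available on row r, so r is put into the support; the strict inequality
  -- `hlt` leaves exactly the room for it.
  have hc : (insert r L).card ≤ 8 * k := (Finset.card_insert_le _ _).trans (by omega)
  obtain ⟨S, hLS, hS⟩ := Finset.exists_superset_card_eq hc (by simpa using hk)
  apply hA
  refine ⟨S, hS, fun j => ⌊u j / θ⌋, fun j => ?_, ?_, fun i hi => ?_⟩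
  · have h1 : |u j / θ| ≤ 1 / θ := by
      rw [abs_div, abs_of_pos hθ]; gcongr; exact hu j
    have h2 := Int.floor_le (u j / θ)
    have h3 := Int.lt_floor_add_one (u j / θ)
    have h4 : |((⌊u j / θ⌋ : ℤ) : ℝ)| ≤ N := by
      rw [abs_le] at *; constructor <;> linarith [h1.1, h1.2]
    exact_mod_cast h4
  · refine hcard.trans (Finset.card_le_card fun j hj => ?_)
    simp only [Finset.mem_filter, Finset.mem_univ, true_and] at hj
    have hjL : j ∈ L := by
      simp only [hL, Finset.mem_filter, Finset.mem_univ, true_and]; linarith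
    rw [Finset.mem_filter]
    refine ⟨hLS (Finset.mem_insert_of_mem hjL), ?_⟩
    have h1 := Int.floor_le (u j / θ)
    have h2 := Int.lt_floor_add_one (u j / θ)
    rw [le_div_iff₀ hθ] at h1
    rw [div_lt_iff₀ hθ] at h2
    -- Rounding moves a coordinate by at most θ ≤ a/2, hence the threshold a/2 in the obstruction.
    have h3 : |u j - θ * ⌊u j / θ⌋| ≤ θ := by
      rw [abs_le]; constructor <;> nlinarith
    have h4 := abs_sub_abs_le_abs_sub (u j) (θ * ⌊u j / θ⌋)
    linarith
  · refine abs_sum_round_le hrow hθ hν heq (fun j hj => ?_)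
      (hLS (Finset.mem_insert_self _ _)) i (Finset.mem_compl.1 hi)
    by_contra! h
    exact hj (hLS (Finset.mem_insert_of_mem (by simpa [hL] using h.le)))

/-- Iterating the spreading step: an approximate eigenvector has at least `8 ^ T` coordinates of
size at least `a T`. -/
lemma pow_le_card_of_not_hasSpreadObstruction {n : ℕ} {A : Matrix (Fin n) (Fin n) ℝ} {a : ℕ → ℝ}
    {T N : ℕ} (hA : ∀ t < T, ¬ HasSpreadObstruction A (a (t + 1)) (a t) (8 ^ t) N)
    (hrow : ∀ i, ∑ j, |A i j| ≤ 2)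
    (ha : ∀ t, 0 < a t) (hadec : ∀ t, a (t + 1) ≤ a t / 2) (hN : 1 / a T + 1 ≤ N)
    (hT : 8 ^ T ≤ n)
    {u : Fin n → ℝ} (hu : ∀ j, |u j| ≤ 1) {ν : ℝ} (hν : |ν| ≤ 3) (r : Fin n)
    (heq : ∀ i, i ≠ r → |∑ j, A i j * u j - ν * u i| ≤ a T) (h0 : ∃ j, a 0 ≤ |u j|) :
    8 ^ T ≤ (Finset.univ.filter fun j => a T ≤ |u j|).card := by
  have hanti : Antitone a := antitone_nat_of_succ_le fun t => by linarith [hadec t, ha t]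
  have key : ∀ t ≤ T, 8 ^ t ≤ (Finset.univ.filter fun j => a t ≤ |u j|).card := by
    intro t
    induction t with
    | zero =>
      intro _
      obtain ⟨j, hj⟩ := h0
      exact Finset.card_pos.2 ⟨j, by simpa using hj⟩
    | succ t ih =>
      intro ht
      rw [pow_succ']
      refine card_le_of_not_hasSpreadObstruction (hA t ht) hrow (ha _) (hadec t) ?_ ?_ hu hν r
        (fun i hi => (heq i hi).trans (hanti ht)) (ih (by omega))
      · refine le_trans ?_ hN
        gcongr
        · exact ha T
        · exact hanti ht
      · rw [← pow_succ']
        exact (Nat.pow_le_pow_right (by norm_num) ht).trans hT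
  exact key T le_rfl

/-- The deterministic part of a row becomes the centre of the small ball, where uniformity in the
centre makes it irrelevant. -/
lemma sum_perturb_mul {n : ℕ} {Abar : Matrix (Fin n) (Fin n) ℝ} {κ : ℝ} (i : Fin n)
    (S : Finset (Fin n)) (c : Fin n → ℝ) (x : Sym2 (Fin n) → ℝ) :
    ∑ j ∈ S, perturb Abar κ x i j * c j
      = ∑ j ∈ S, (1 / ((n : ℝ) ^ 2 * κ) * c j) * x s(i, j) - -∑ j ∈ S, Abar i j * c j := by
  rw [sub_neg_eq_add, ← Finset.sum_add_distrib]
  refine Finset.sum_congr rfl fun j _ => ?_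
  simp only [perturb, Matrix.of_apply]; ring

lemma measure_abs_gt_le {Ω : Type*} [MeasurableSpace Ω] {μ : Measure Ω} {n : ℕ} {p : ℝ}
    {X : Sym2 (Fin n) → Ω → ℝ} (hX : ∀ e, Measurable (X e))
    (hlaw : ∀ e, μ.map (X e) = sparseGaussian p) (hp1 : p ≤ 1) {B : ℝ} (hB : 0 ≤ B) :
    μ {ω | ∃ e, B < |X e ω|} ≤ ENNReal.ofReal ((n : ℝ) ^ 2 * (2 * Real.exp (-B ^ 2 / 2))) := by
  have hsub : {ω | ∃ e, B < |X e ω|} ⊆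
      ⋃ q ∈ (Finset.univ : Finset (Fin n × Fin n)), {ω | B < |X s(q.1, q.2) ω|} := by
    rintro ω ⟨e, he⟩
    induction e using Sym2.ind with
    | _ i j => simp only [Set.mem_iUnion]; exact ⟨(i, j), Finset.mem_univ _, he⟩
  refine (measure_mono hsub).trans ((measure_biUnion_finset_le _ _).trans ?_)
  calc _ ≤ ∑ _q : Fin n × Fin n, ENNReal.ofReal (2 * Real.exp (-B ^ 2 / 2)) := by
        refine Finset.sum_le_sum fun q _ => ?_
        refine le_trans (le_of_eq ?_) (sparseGaussian_abs_gt_le hp1 hB)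
        rw [← hlaw s(q.1, q.2), Measure.map_apply (hX _)
          (measurableSet_lt measurable_const (by fun_prop))]
        rfl
    _ = _ := by
        rw [Finset.sum_const, nsmul_eq_mul, ENNReal.ofReal_mul (p := (n : ℝ) ^ 2) (by positivity)]
        congr 1
        simp [sq]

/-! ### Probability of spread obstructions and of column obstructions -/

section Probability

variable {Ω : Type*} [MeasurableSpace Ω] {μ : Measure Ω} [IsProbabilityMeasure μ]
  {n : ℕ} {Abar : Matrix (Fin n) (Fin n) ℝ} {κ p : ℝ} {X : Sym2 (Fin n) → Ω → ℝ}

lemma measure_row_le (hn : 0 < n) (hκ : 0 < κ) (hp : p ∈ Set.Icc (0 : ℝ) 1)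
    (hX : ∀ e, Measurable (X e)) (hind : iIndepFun X μ)
    (hlaw : ∀ e, μ.map (X e) = sparseGaussian p) (i : Fin n) (S : Finset (Fin n))
    (c : Fin n → ℝ) {b t : ℝ} (hb : 0 < b) (ht : 0 ≤ t) (k : ℕ)
    (hk : k ≤ (S.filter fun j => b ≤ |c j|).card) :
    μ {ω | |∑ j ∈ S, (1 / ((n : ℝ) ^ 2 * κ) * c j) * X s(i, j) ω - -∑ j ∈ S, Abar i j * c j| ≤ t}
      ≤ ENNReal.ofReal ((1 - p) ^ k + t * ((n : ℝ) ^ 2 * κ) / b) := by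
  have hn' : (0 : ℝ) < n := by exact_mod_cast hn
  have hinj : Function.Injective fun j : Fin n => s(i, j) := fun j j' h => by
    simpa using Sym2.congr_right.1 h
  set ε := 1 / ((n : ℝ) ^ 2 * κ) with hε
  have hε0 : 0 < ε := by positivity
  refine (concentration_sum_le (X := fun j => X s(i, j)) hp (fun j => hX _) (hind.precomp hinj)
    (fun j => hlaw _) (fun j => ε * c j) (mul_pos hε0 hb) ht S _).trans ?_
  apply ENNReal.ofReal_le_ofReal
  have h1 : ∀ j, ε * b ≤ |ε * c j| ↔ b ≤ |c j| := fun j => by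
    rw [abs_mul, abs_of_pos hε0]; exact mul_le_mul_iff_right₀ hε0
  simp only [h1]
  apply add_le_add
  · exact pow_le_pow_of_le_one (by linarith [hp.2]) (by linarith [hp.1]) hk
  · apply le_of_eq; rw [hε]; field_simp

lemma measure_isSpreadObstruction_le (hn : 0 < n) (hκ : 0 < κ) (hp : p ∈ Set.Icc (0 : ℝ) 1)
    (hX : ∀ e, Measurable (X e)) (hind : iIndepFun X μ)
    (hlaw : ∀ e, μ.map (X e) = sparseGaussian p) {θ a : ℝ} (hθ : 0 < θ) (ha : 0 < a) {k : ℕ}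
    {S : Finset (Fin n)} (hS : S.card = 8 * k) (z : Fin n → ℤ) :
    μ {ω | IsSpreadObstruction (perturb Abar κ (fun e => X e ω)) θ a k S z}
      ≤ ENNReal.ofReal ((1 - p) ^ k + 16 * θ * ((n : ℝ) ^ 2 * κ) / a) ^ (n - 8 * k) := by
  by_cases hk : k ≤ (S.filter fun j => a / 2 ≤ |θ * (z j : ℝ)|).card
  · simp only [IsSpreadObstruction, hk, true_and, sum_perturb_mul]
    have hcard : Sᶜ.card = n - 8 * k := by rw [Finset.card_compl, hS, Fintype.card_fin]
    rw [← hcard]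
    refine concentration_forall_le hX hind
      (fun j => 1 / ((n : ℝ) ^ 2 * κ) * (θ * z j)) (8 * θ) (fun i j => s(i, j)) S
      (fun i => -∑ j ∈ S, Abar i j * (θ * z j)) _ Sᶜ ?_ ?_
    · intro i hi i' hi' hii' j hj j' hj' h
      -- Each pair has exactly one endpoint outside S, so distinct rows use disjoint noise despite
      -- the symmetry of the matrix.
      rcases Sym2.eq_iff.1 h with ⟨h, -⟩ | ⟨h, -⟩
      · exact hii' h
      · exact Finset.mem_compl.1 hi (h ▸ hj')
    · intro i _
      refine (measure_row_le hn hκ hp hX hind hlaw i S (fun j => θ * z j) (half_pos ha)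
        (by positivity) k hk).trans (le_of_eq ?_)
      congr 2; field_simp; ring
  · simp only [IsSpreadObstruction, hk, false_and]; simp

lemma measure_hasSpreadObstruction_le (hn : 0 < n) (hκ : 0 < κ) (hp : p ∈ Set.Icc (0 : ℝ) 1)
    (hX : ∀ e, Measurable (X e)) (hind : iIndepFun X μ)
    (hlaw : ∀ e, μ.map (X e) = sparseGaussian p) {θ a : ℝ} (hθ : 0 < θ) (ha : 0 < a) (k N : ℕ) :
    μ {ω | HasSpreadObstruction (perturb Abar κ (fun e => X e ω)) θ a k N}
      ≤ ENNReal.ofReal (((n : ℝ) * (2 * N + 1)) ^ (8 * k) *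
        ((1 - p) ^ k + 16 * θ * ((n : ℝ) ^ 2 * κ) / a) ^ (n - 8 * k)) := by
  -- The obstruction reads z only on S; setting z to 0 elsewhere leaves (2N + 1)^(8k) candidates for
  -- each S.
  let Zs : Finset (Fin n) → Finset (Fin n → ℤ) := fun S =>
    Fintype.piFinset fun j => if j ∈ S then Finset.Icc (-(N : ℤ)) N else {0}
  have hsub : {ω | HasSpreadObstruction (perturb Abar κ (fun e => X e ω)) θ a k N} ⊆
      ⋃ S ∈ Finset.powersetCard (8 * k) (Finset.univ : Finset (Fin n)), ⋃ z ∈ Zs S,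
        {ω | IsSpreadObstruction (perturb Abar κ (fun e => X e ω)) θ a k S z} := by
    rintro ω ⟨S, hS, z, hz, hk, hrow⟩
    simp only [Set.mem_iUnion]
    refine ⟨S, by simp [hS], fun j => if j ∈ S then z j else 0, ?_, ?_, ?_⟩
    · simp only [Zs, Fintype.mem_piFinset]
      intro j
      by_cases hj : j ∈ S
      · simpa [hj] using abs_le.1 (hz j)
      · simp [hj]
    · refine hk.trans (le_of_eq ?_)
      congr 1
      exact Finset.filter_congr fun j hj => by simp [hj]
    · intro i hi
      rw [← Finset.sum_congr rfl fun j hj => ?_]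
      · exact hrow i hi
      · simp [hj]
  have hcardZ : ∀ S : Finset (Fin n), S.card = 8 * k → (Zs S).card = (2 * N + 1) ^ (8 * k) := by
    intro S hS
    simp only [Zs, Fintype.card_piFinset]
    have : ∀ j, (if j ∈ S then Finset.Icc (-(N : ℤ)) N else {0}).card
        = if j ∈ S then 2 * N + 1 else 1 := by
      intro j; split_ifs
      · rw [Int.card_Icc]; omega
      · simp
    simp only [this]
    rw [Finset.prod_ite_mem, Finset.univ_inter, Finset.prod_const, hS]
  have hq0 : 0 ≤ (1 - p) ^ k + 16 * θ * ((n : ℝ) ^ 2 * κ) / a := by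
    have : 0 ≤ 1 - p := by linarith [hp.2]
    positivity
  set q := ENNReal.ofReal ((1 - p) ^ k + 16 * θ * ((n : ℝ) ^ 2 * κ) / a) ^ (n - 8 * k) with hq
  calc _ ≤ ∑ S ∈ Finset.powersetCard (8 * k) (Finset.univ : Finset (Fin n)), ∑ z ∈ Zs S, q := by
        refine (measure_mono hsub).trans ((measure_biUnion_finset_le _ _).trans ?_)
        refine Finset.sum_le_sum fun S hS => ?_
        refine (measure_biUnion_finset_le _ _).trans (Finset.sum_le_sum fun z _ => ?_)
        exact measure_isSpreadObstruction_le hn hκ hp hX hind hlaw hθ ha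
          (Finset.mem_powersetCard.1 hS).2 z
    _ = (n.choose (8 * k) : ℝ≥0∞) * (((2 * N + 1) ^ (8 * k) : ℕ) * q) := by
        rw [Finset.sum_congr rfl (g := fun _ => (((2 * N + 1) ^ (8 * k) : ℕ) : ℝ≥0∞) * q)]
        · simp [Finset.card_powersetCard]
        · intro S hS
          rw [Finset.sum_const, hcardZ S (Finset.mem_powersetCard.1 hS).2, nsmul_eq_mul]
    _ ≤ ((n ^ (8 * k) : ℕ) : ℝ≥0∞) * (((2 * N + 1) ^ (8 * k) : ℕ) * q) := by
        gcongr; exact Nat.choose_le_pow n (8 * k)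
    _ = _ := by
        rw [ENNReal.ofReal_mul (by positivity), ENNReal.ofReal_pow hq0, ← hq, ← mul_assoc,
          ← Nat.cast_mul, ← ENNReal.ofReal_natCast]
        congr 2
        push_cast; rw [mul_pow]

/-- The principal minor of the perturbed matrix with index `k` removed; the removed index is kept as
an isolated coordinate with diagonal entry `10`. -/
noncomputable def minor (Abar : Matrix (Fin n) (Fin n) ℝ) (κ : ℝ) (k : Fin n)
    (x : Sym2 (Fin n) → ℝ) : Matrix (Fin n) (Fin n) ℝ :=
  Matrix.of fun i j => if i = k then if j = k then 10 else 0 else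
    if j = k then 0 else perturb Abar κ x i j

lemma isHermitian_minor (hA : Abar.IsHermitian) (κ : ℝ) (k : Fin n) (x : Sym2 (Fin n) → ℝ) :
    (minor Abar κ k x).IsHermitian := by
  ext i j
  have h : perturb Abar κ x j i = perturb Abar κ x i j := by
    simpa using (isHermitian_perturb hA κ x).apply i j
  by_cases hi : i = k <;> by_cases hj : j = k <;> simp [minor, hi, hj, h]

/-- Round the noise to the grid `ρ ℤ` and erase it on the pairs containing `k`. -/
noncomputable def roundOff (ρ : ℝ) (k : Fin n) (x : Sym2 (Fin n) → ℝ) : Sym2 (Fin n) → ℝ :=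
  fun e => if k ∈ e then 0 else ρ * ⌊x e / ρ⌋

lemma abs_perturb_sub_minor_le (hn : 0 < n) (hκ : 1 ≤ κ) {ρ : ℝ} (hρ : 0 < ρ) (k i j : Fin n)
    (hi : i ≠ k) (hj : j ≠ k) (x : Sym2 (Fin n) → ℝ) :
    |perturb Abar κ x i j - minor Abar κ k (roundOff ρ k x) i j| ≤ ρ := by
  have hn' : (1 : ℝ) ≤ n := by exact_mod_cast hn
  have hk : ¬ (k = i ∨ k = j) := by rintro (h | h) <;> simp_all
  simp only [minor, perturb, roundOff, Matrix.of_apply, hi, hj, if_false, Sym2.mem_iff, hk]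
  rw [add_sub_add_left_eq_sub, ← mul_sub, abs_mul]
  have h1 := Int.floor_le (x s(i, j) / ρ)
  have h2 := Int.lt_floor_add_one (x s(i, j) / ρ)
  rw [le_div_iff₀ hρ] at h1
  rw [div_lt_iff₀ hρ] at h2
  have h3 : |x s(i, j) - ρ * ⌊x s(i, j) / ρ⌋| ≤ ρ := by
    rw [abs_le]; constructor <;> nlinarith
  have h4 : |1 / ((n : ℝ) ^ 2 * κ)| ≤ 1 := by
    rw [abs_of_pos (by positivity)]
    apply div_le_one_of_le₀ _ (by positivity)
    exact one_le_mul_of_one_le_of_one_le (one_le_pow₀ hn') hκ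
  calc _ ≤ 1 * ρ := mul_le_mul h4 h3 (abs_nonneg _) zero_le_one
    _ = ρ := one_mul ρ

/-- The `l`-th eigenvector of the rounded minor is spread but almost orthogonal to the removed
column. -/
def IsColumnObstruction (hA : Abar.IsHermitian) (κ ρ b t : ℝ) (m : ℕ) (k l : Fin n)
    (x : Sym2 (Fin n) → ℝ) : Prop :=
  let u := (isHermitian_minor hA κ k (roundOff ρ k x)).eigenvectorBasis l
  m ≤ (Finset.univ.filter fun j => b ≤ |u j|).card ∧ |∑ j, perturb Abar κ x k j * u j| ≤ t

lemma measure_isColumnObstruction_le (hn : 0 < n) (hκ : 0 < κ) (hp : p ∈ Set.Icc (0 : ℝ) 1)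
    (hX : ∀ e, Measurable (X e)) (hind : iIndepFun X μ)
    (hlaw : ∀ e, μ.map (X e) = sparseGaussian p) (hA : Abar.IsHermitian) {ρ b t : ℝ}
    (hb : 0 < b) (ht : 0 ≤ t) (m : ℕ) (k l : Fin n) :
    μ {ω | IsColumnObstruction hA κ ρ b t m k l (fun e => X e ω)}
      ≤ ENNReal.ofReal ((1 - p) ^ m + t * ((n : ℝ) ^ 2 * κ) / b) := by
  -- The eigenvector depends only on floors of the noise in P, and row k only on the noise in Q. The
  -- floors take countably many values, so the choice of eigenvector need not be measurable in the
  -- noise.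
  let P : Finset (Sym2 (Fin n)) := Finset.univ.filter fun e => k ∉ e
  let Q : Finset (Sym2 (Fin n)) := Finset.univ.filter fun e => k ∈ e
  have hPQ : Disjoint P Q := by
    rw [Finset.disjoint_left]; intro e h1 h2
    simp only [P, Q, Finset.mem_filter, Finset.mem_univ, true_and] at h1 h2
    exact h1 h2
  have hQ : ∀ j, s(k, j) ∈ Q := fun j => by simp [Q]
  let φ : (P → ℝ) → P → ℤ := fun x e => ⌊x e / ρ⌋
  have happ (e : P) : Measurable fun x : P → ℝ => x e := measurable_pi_apply e
  have hφ : Measurable φ := measurable_pi_lambda _ fun e =>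
    Int.measurable_floor.comp ((happ e).div_const ρ)
  let Z : Ω → P → ℤ := fun ω => φ fun e => X e ω
  let W : Ω → Q → ℝ := fun ω e => X e ω
  have hZ : Measurable Z := hφ.comp (measurable_pi_lambda _ fun e => hX e)
  have hZW : IndepFun Z W μ := (hind.indepFun_finset P Q hPQ hX).comp hφ measurable_id
  let ext : (P → ℤ) → Sym2 (Fin n) → ℝ := fun z e => if h : e ∈ P then ρ * z ⟨e, h⟩ else 0
  have hext : ∀ ω, roundOff ρ k (fun e => X e ω) = ext (Z ω) := by
    intro ω; funext e
    by_cases h : k ∈ e <;> simp [roundOff, ext, P, Z, φ, h]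
  let u : (P → ℤ) → Fin n → ℝ := fun z j =>
    (isHermitian_minor hA κ k (ext z)).eigenvectorBasis l j
  let B : (P → ℤ) → Set (Q → ℝ) := fun z =>
    {x | m ≤ (Finset.univ.filter fun j => b ≤ |u z j|).card ∧
      |∑ j, (1 / ((n : ℝ) ^ 2 * κ) * u z j) * x ⟨s(k, j), hQ j⟩ - -∑ j, Abar k j * u z j| ≤ t}
  have hform (z : P → ℤ) : Measurable fun x : Q → ℝ =>
      |∑ j, (1 / ((n : ℝ) ^ 2 * κ) * u z j) * x ⟨s(k, j), hQ j⟩ - -∑ j, Abar k j * u z j| :=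
    Measurable.abs (Measurable.sub_const (Finset.measurable_fun_sum _ fun j _ =>
      (measurable_pi_apply (X := fun _ : Q => ℝ) _).const_mul _) _)
  have hB : ∀ z, MeasurableSet (B z) := fun z =>
    MeasurableSet.inter (MeasurableSet.const _) (measurableSet_le (hform z) measurable_const)
  have hset : {ω | IsColumnObstruction hA κ ρ b t m k l (fun e => X e ω)}
      = {ω | W ω ∈ B (Z ω)} := by
    ext ω
    simp only [IsColumnObstruction, Set.mem_ofPred_eq, sum_perturb_mul, B, u, W]
    simp only [hext]
  rw [hset]
  refine measure_mem_le_of_indepFun hZ hZW B hB _ fun z => ?_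
  by_cases hm : m ≤ (Finset.univ.filter fun j => b ≤ |u z j|).card
  · refine le_trans (measure_mono fun ω hω => ?_)
      (measure_row_le (Abar := Abar) hn hκ hp hX hind hlaw k Finset.univ (u z) hb ht m hm)
    exact hω.2
  · refine le_trans (measure_mono (t := ∅) fun ω hω => ?_) (by simp)
    exact hm hω.1

end Probability

/-! ### Deterministic conclusion: no obstruction implies separation -/

/-- If the noise is bounded and there are no obstructions then the eigenvalues are separated. -/
lemma eigenvaluesSeparated_of_not_obstruction {n : ℕ} (hn : 0 < n)
    {Abar : Matrix (Fin n) (Fin n) ℝ} {κ : ℝ} (hκ : 1 ≤ κ) (hA : Abar.IsHermitian)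
    (hAb : ∀ i j, |Abar i j| ≤ 1 / n) {x : Sym2 (Fin n) → ℝ} (hx : ∀ e, |x e| ≤ n * κ)
    {δ : ℝ} (hδ : 0 < δ) (hδ1 : 2 * (n : ℝ) ^ 2 * δ ≤ 1) {a : ℕ → ℝ} {T N m : ℕ}
    (ha : ∀ t, 0 < a t) (hadec : ∀ t, a (t + 1) ≤ a t / 2) (hN : 1 / a T + 1 ≤ N)
    (ha0 : a 0 ≤ 1 / n) (haT : n * δ ≤ a T) (hT : 8 ^ T ≤ n) (hm : m ≤ 8 ^ T)
    (hspread : ∀ t < T, ¬ HasSpreadObstruction (perturb Abar κ x) (a (t + 1)) (a t) (8 ^ t) N)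
    (hcol : ∀ k l, ¬ IsColumnObstruction hA κ δ (a T) (4 * (n : ℝ) ^ 4 * δ) m k l x) :
    EigenvaluesSeparated (perturb Abar κ x) δ := by
  have hrow := sum_abs_perturb_le hn (zero_lt_one.trans_le hκ) hAb hx
  refine ⟨isHermitian_perturb hA κ x, fun i j hij => ?_⟩
  by_contra! hlt
  obtain ⟨k, l, hν, -, heq, hdot⟩ := exists_minor_eigenvector (isHermitian_perturb hA κ x) hrow
    hδ.le hδ1 hij hlt.le (M := fun k => minor Abar κ k (roundOff δ k x))
    (fun k => isHermitian_minor hA κ k _) (fun k => by simp [minor])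
    (fun k j hj => by simp [minor, hj])
    (fun k i j hi hj => abs_perturb_sub_minor_le hn hκ hδ k i j hi hj x)
  refine hcol k l ⟨hm.trans ?_, hdot⟩
  refine pow_le_card_of_not_hasSpreadObstruction hspread hrow ha hadec hN hT
    (abs_eigenvectorBasis_le_one _ l) hν k (fun i hi => (heq i hi).trans haT) ?_
  obtain ⟨j, hj⟩ := exists_inv_le_abs_eigenvectorBasis
    (isHermitian_minor hA κ k (roundOff δ k x)) l
  exact ⟨j, ha0.trans hj⟩

/-! ### Numerical relations between the parameters -/

section Numerics

/-- Bootstrapping: log n ≥ c gives n ≥ 900c², hence a better lower bound on log n. Starting from log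
2, the successive bounds are 6, 10 and 11. -/
lemma eleven_le_log {n : ℕ} (hn : 2 ≤ n) (h : 900 * Real.log n ^ 2 ≤ n) : 11 ≤ Real.log n := by
  have hn' : (2 : ℝ) ≤ n := by exact_mod_cast hn
  have h0 : (0.69 : ℝ) ≤ Real.log n :=
    le_trans (by linarith [Real.log_two_gt_d9]) (Real.log_le_log (by norm_num) hn')
  have step : ∀ (k : ℕ) (c : ℝ), 0 ≤ c → c ≤ Real.log n → (2.7182818286 : ℝ) ^ k ≤ 900 * c ^ 2 →
      (k : ℝ) ≤ Real.log n := by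
    intro k c hc hcl hk
    rw [Real.le_log_iff_exp_le (by linarith), ← Real.exp_one_pow]
    calc Real.exp 1 ^ k ≤ (2.7182818286 : ℝ) ^ k := by
          gcongr; exact Real.exp_one_lt_d9.le
      _ ≤ 900 * c ^ 2 := hk
      _ ≤ 900 * Real.log n ^ 2 := by gcongr
      _ ≤ n := h
  have h6 := step 6 _ (by norm_num) h0 (by norm_num)
  have h10 := step 10 _ (by norm_num) h6 (by norm_num)
  exact_mod_cast step 11 _ (by norm_num) h10 (by norm_num)

/-- The numerical relations between the parameters `l = log n`, `L = log κ` and `p`. -/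
structure Parameters (n : ℕ) (κ p l L : ℝ) : Prop where
  n_eq : (n : ℝ) = Real.exp l
  κ_eq : κ = Real.exp L
  eleven_le : 11 ≤ l
  le_L : 3 * l ≤ L
  p_pos : 0 < p
  p_le : p ≤ 1
  mul_le : 300 * L * l ≤ p * n

lemma parameters_of_le {n : ℕ} {κ p : ℝ} (hn : 2 ≤ n) (hκ : (n : ℝ) ^ 3 ≤ κ)
    (hp : 300 * Real.log κ * Real.log n / n ≤ p) (hp1 : p ≤ 1) :
    Parameters n κ p (Real.log n) (Real.log κ) := by
  have hn' : (2 : ℝ) ≤ n := by exact_mod_cast hn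
  have hn0 : (0 : ℝ) < n := by linarith
  have hκ0 : 0 < κ := lt_of_lt_of_le (by positivity) hκ
  have hL : 3 * Real.log n ≤ Real.log κ := by
    have := Real.log_le_log (by positivity) hκ
    rwa [Real.log_pow] at this
  have hl0 : 0 < Real.log n := Real.log_pos (by linarith)
  have hmul := hp
  rw [div_le_iff₀ hn0] at hmul
  -- This combines p ≤ 1 with log κ ≥ 3 log n.
  have h900 : 900 * Real.log n ^ 2 ≤ n := by nlinarith
  refine ⟨(Real.exp_log hn0).symm, (Real.exp_log hκ0).symm, eleven_le_log hn h900, hL, ?_, hp1,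
    hmul⟩
  refine lt_of_lt_of_le ?_ hp
  have : 0 < Real.log κ := by linarith
  positivity

namespace Parameters

variable {n : ℕ} {κ p l L : ℝ}

lemma n_pow (P : Parameters n κ p l L) (k : ℕ) : (n : ℝ) ^ k = Real.exp (k * l) := by
  rw [P.n_eq, ← Real.exp_nat_mul]

lemma κ_rpow (P : Parameters n κ p l L) : κ ^ (-5 * l) = Real.exp (-(5 * L * l)) := by
  rw [P.κ_eq, ← Real.exp_mul]; ring_nf

lemma le_n (P : Parameters n κ p l L) : 1000 ≤ (n : ℝ) := by
  rw [P.n_eq]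
  calc (1000 : ℝ) ≤ 2 ^ 11 := by norm_num
    _ ≤ Real.exp 1 ^ 11 := by gcongr; linarith [Real.exp_one_gt_d9]
    _ = Real.exp 11 := by rw [Real.exp_one_pow]; norm_num
    _ ≤ Real.exp l := Real.exp_le_exp.2 P.eleven_le

lemma le_exp (P : Parameters n κ p l L) {c : ℝ} (hc : c ≤ 1000) : c ≤ Real.exp l :=
  hc.trans (P.n_eq ▸ P.le_n)

/-- Here m = ⌈13l/p⌉ is the spread needed for (1 - p)^m ≤ n^(-13), and T is the least number of
eightfold spreadings reaching it. Minimality of T keeps every earlier scale below 13l/p. -/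
lemma exists_clog_bound (P : Parameters n κ p l L) :
    ∃ m T : ℕ, 13 * l ≤ p * m ∧ m ≤ 8 ^ T ∧ 8 ^ T ≤ n ∧ 7 * (T : ℝ) ≤ 5 * l - 9 ∧
      ∀ t < T, p * 8 ^ t ≤ 13 * l := by
  have hl := P.eleven_le
  have hL := P.le_L
  have hp := P.p_pos
  have hn := P.le_n
  set m := ⌈13 * l / p⌉₊ with hm
  have hm1 : 13 * l ≤ p * m := by
    have := Nat.le_ceil (13 * l / p)
    rw [div_le_iff₀ hp] at this
    linarith
  have hlt : ∀ t < Nat.clog 8 m, p * 8 ^ t ≤ 13 * l := by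
    intro t ht
    have h1 : 8 ^ t < m := by
      by_contra! h
      exact absurd (Nat.clog_le_of_le_pow h) (by omega)
    have h2 := Nat.lt_ceil.1 h1
    rw [lt_div_iff₀ hp] at h2
    push_cast at h2
    linarith
  have hlt' : ∀ t < Nat.clog 8 m, 16 * (8 : ℝ) ^ t ≤ n := by
    intro t ht
    have h1 := hlt t ht
    have h2 : 300 * (p * 8 ^ t) * l ≤ 13 * l * (p * n) := by
      have h300 : 300 * l ≤ p * n := by
        have := P.mul_le
        nlinarith
      have e1 := mul_le_mul_of_nonneg_left h300 (by linarith : 0 ≤ 13 * l)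
      have e2 := mul_le_mul_of_nonneg_right h1 (by linarith : 0 ≤ 300 * l)
      linarith
    have h3 : 300 * 8 ^ t ≤ 13 * (n : ℝ) := by
      have : (p * l) * (300 * 8 ^ t) ≤ (p * l) * (13 * (n : ℝ)) := by linarith
      exact le_of_mul_le_mul_left this (by positivity)
    linarith
  refine ⟨m, Nat.clog 8 m, hm1, Nat.le_pow_clog (by norm_num) m, ?_, ?_, hlt⟩
  · rcases Nat.eq_zero_or_pos (Nat.clog 8 m) with h | h
    · rw [h, pow_zero]
      have : (1 : ℝ) ≤ n := by linarith
      exact_mod_cast this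
    · have h1 := hlt' (Nat.clog 8 m - 1) (by omega)
      have h2 : (8 : ℝ) ^ Nat.clog 8 m = 8 * 8 ^ (Nat.clog 8 m - 1) := by
        rw [← pow_succ']; congr 1; omega
      have : (8 : ℝ) ^ Nat.clog 8 m ≤ n := by
        rw [h2]
        have : (0 : ℝ) < 8 ^ (Nat.clog 8 m - 1) := by positivity
        linarith
      exact_mod_cast this
  · rcases Nat.eq_zero_or_pos (Nat.clog 8 m) with h | h
    · rw [h]; push_cast; linarith
    · obtain ⟨t, ht⟩ : ∃ t, Nat.clog 8 m = t + 1 := ⟨Nat.clog 8 m - 1, by omega⟩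
      have h1 := hlt' t (by omega)
      -- Since e² ≤ 8, the bound 16 · 8^t ≤ n gives 2(T - 1) ≤ l, so 7T ≤ 7l/2 + 7; this is at most
      -- 5l - 9 because l ≥ 11.
      have h2 : Real.exp (2 * t) ≤ Real.exp l := by
        rw [← P.n_eq]
        refine le_trans ?_ h1
        rw [mul_comm, Real.exp_nat_mul]
        have h3 : Real.exp 2 ≤ 8 := by
          rw [show (2 : ℝ) = (2 : ℕ) * 1 by norm_num, Real.exp_nat_mul]
          have := Real.exp_one_lt_d9
          have := Real.exp_pos 1
          nlinarith
        have h4 : Real.exp 2 ^ t ≤ 8 ^ t := by gcongr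
        have h5 : (0 : ℝ) < 8 ^ t := by positivity
        linarith
      rw [Real.exp_le_exp] at h2
      rw [ht]; push_cast; linarith

/-- When pk is tiny the bound is close to 1, so τ must be small compared with pk. It is: τ ≤
exp(-13l)exp(-l), with exp(-13l) ≤ exp(-pk) and 1/n ≤ pk/2. -/
lemma row_le (P : Parameters n κ p l L) {k : ℕ} (hk : 0 < k) (hpk : p * k ≤ 13 * l) {τ : ℝ} (hτ : τ ≤ Real.exp (-14 * l)) :
    (1 - p) ^ k + τ ≤ Real.exp (-(p * k / 2)) := by
  have hl := P.eleven_le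
  have hk1 : (1 : ℝ) ≤ k := by exact_mod_cast hk
  have h1 : (1 - p) ^ k ≤ Real.exp (-(p * k)) := by
    have : 1 - p ≤ Real.exp (-p) := by linarith [Real.add_one_le_exp (-p)]
    calc (1 - p) ^ k ≤ Real.exp (-p) ^ k :=
          pow_le_pow_left₀ (by linarith [P.p_le]) this k
      _ = Real.exp (-(p * k)) := by rw [← Real.exp_nat_mul]; ring_nf
  have h2 : Real.exp (-l) ≤ p * k / 2 := by
    have h3 : 2 ≤ p * n := by
      have := P.mul_le; have := P.le_L; nlinarith
    rw [P.n_eq] at h3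
    have h4 : Real.exp (-l) * Real.exp l = 1 := by rw [← Real.exp_add]; simp
    have h5 : 2 * Real.exp (-l) ≤ p := by
      have := mul_le_mul_of_nonneg_left h3 (Real.exp_pos (-l)).le
      nlinarith
    nlinarith [P.p_pos]
  have h6 : τ ≤ Real.exp (-(p * k)) * (p * k / 2) := by
    calc τ ≤ Real.exp (-14 * l) := hτ
      _ = Real.exp (-13 * l) * Real.exp (-l) := by rw [← Real.exp_add]; ring_nf
      _ ≤ _ := by
        gcongr; linarith
  calc _ ≤ Real.exp (-(p * k)) * (p * k / 2 + 1) := by linarith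
    _ ≤ Real.exp (-(p * k)) * Real.exp (p * k / 2) := by
      gcongr; exact Real.add_one_le_exp _
    _ = _ := by rw [← Real.exp_add]; ring_nf

/-- Entropy against probability: at least n/2 rows remain, contributing exponent -pkn/4 ≤ -75kLl,
which beats the entropy 40kLl. -/
lemma spread_bound (P : Parameters n κ p l L) {k N : ℕ} (hk : 0 < k) (hpk : p * k ≤ 13 * l) {τ : ℝ} (hτ0 : 0 ≤ τ)
    (hτ : τ ≤ Real.exp (-14 * l)) (hN : (n : ℝ) * (2 * N + 1) ≤ Real.exp (5 * L * l)) :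
    ((n : ℝ) * (2 * N + 1)) ^ (8 * k) * ((1 - p) ^ k + τ) ^ (n - 8 * k) ≤ Real.exp (-12 * l) := by
  have hl := P.eleven_le
  have hL := P.le_L
  have hp := P.p_pos
  have hk1 : (1 : ℝ) ≤ k := by exact_mod_cast hk
  have hmul := P.mul_le
  have h16 : 16 * (k : ℝ) ≤ n := by
    have h2 : 300 * (p * k) * l ≤ 13 * l * (p * n) := by
      have h300 : 300 * l ≤ p * n := by nlinarith
      have e1 := mul_le_mul_of_nonneg_left h300 (by linarith : 0 ≤ 13 * l)
      have e2 := mul_le_mul_of_nonneg_right hpk (by linarith : 0 ≤ 300 * l)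
      linarith
    have h3 : (p * l) * (300 * k) ≤ (p * l) * (13 * (n : ℝ)) := by linarith
    have := le_of_mul_le_mul_left h3 (by positivity)
    linarith
  have h8 : 8 * k ≤ n := by
    have : (8 : ℝ) * k ≤ n := by linarith
    exact_mod_cast this
  have hsub : (n : ℝ) / 2 ≤ ((n - 8 * k : ℕ) : ℝ) := by
    rw [Nat.cast_sub h8]; push_cast; linarith
  calc _ ≤ Real.exp (5 * L * l) ^ (8 * k) * Real.exp (-(p * k / 2)) ^ (n - 8 * k) := by
        have h0 : 0 ≤ (1 - p) ^ k + τ := by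
          have : 0 ≤ 1 - p := by linarith [P.p_le]
          positivity
        gcongr
        exact P.row_le hk hpk hτ
    _ = Real.exp (40 * (k * (L * l)) - p * k / 2 * (n - 8 * k : ℕ)) := by
        rw [← Real.exp_nat_mul, ← Real.exp_nat_mul, ← Real.exp_add]
        congr 1; push_cast; ring
    _ ≤ Real.exp (-12 * l) := by
        rw [Real.exp_le_exp]
        have e1 : p * k / 2 * (n / 2) ≤ p * k / 2 * ((n - 8 * k : ℕ) : ℝ) := by gcongr
        have e2 : k * (300 * L * l) ≤ k * (p * n) := by gcongr
        have e3 : 33 * l ≤ L * l := by nlinarith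
        have e4 : L * l ≤ k * (L * l) := le_mul_of_one_le_left (by nlinarith) hk1
        nlinarith

end Parameters

end Numerics

/-! ### Probabilities of the bad events with the chosen parameters -/

lemma Parameters.measure_abs_gt_le {Ω : Type*} [MeasurableSpace Ω] {μ : Measure Ω} {n : ℕ}
    {κ p l L : ℝ} {X : Sym2 (Fin n) → Ω → ℝ} (P : Parameters n κ p l L)
    (hX : ∀ e, Measurable (X e)) (hlaw : ∀ e, μ.map (X e) = sparseGaussian p) :
    μ {ω | ∃ e, n * κ < |X e ω|} ≤ ENNReal.ofReal (Real.exp (-11 * l)) := by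
  have hl := P.eleven_le
  have hn := P.le_n
  have hκ : n ≤ κ := by
    rw [P.n_eq, P.κ_eq, Real.exp_le_exp]; linarith [P.le_L]
  have hκ0 : 0 < κ := by linarith
  refine (SparsePerturbation.measure_abs_gt_le hX hlaw P.p_le (by positivity)).trans
    (ENNReal.ofReal_le_ofReal ?_)
  have h2 := P.le_exp (c := 2) (by norm_num)
  have hln : l ≤ n := by rw [P.n_eq]; linarith [Real.add_one_le_exp l]
  have hB : 14 * l ≤ ((n : ℝ) * κ) ^ 2 / 2 := by
    have h3 : (n : ℝ) * n ≤ n * κ := by gcongr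
    have h4 : 1000 * l ≤ n * κ := by nlinarith
    nlinarith
  calc (n : ℝ) ^ 2 * (2 * Real.exp (-(n * κ) ^ 2 / 2))
      ≤ Real.exp (2 * l) * (Real.exp l * Real.exp (-(14 * l))) := by
        have h4 : (n : ℝ) ^ 2 = Real.exp (2 * l) := by exact_mod_cast P.n_pow 2
        have h5 : -(n * κ) ^ 2 / 2 ≤ -(14 * l) := by linarith
        rw [h4]; gcongr
    _ = Real.exp (-11 * l) := by rw [← Real.exp_add, ← Real.exp_add]; ring_nf

section Final

variable {Ω : Type*} [MeasurableSpace Ω] {μ : Measure Ω} [IsProbabilityMeasure μ]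
  {n : ℕ} {Abar : Matrix (Fin n) (Fin n) ℝ} {κ p l L : ℝ} {X : Sym2 (Fin n) → Ω → ℝ}

/-- The thresholds exp(-(7t + 1)L) drop by κ^(-7) per scale: one κ undoes the noise scaling, and the
other six, with L ≥ 3l, absorb 16n² and leave at most n^(-14). The bound on 7T keeps the grid
entropy below 5Ll per coordinate. -/
lemma Parameters.measure_hasSpreadObstruction_le (P : Parameters n κ p l L)
    (hX : ∀ e, Measurable (X e)) (hind : iIndepFun X μ)
    (hlaw : ∀ e, μ.map (X e) = sparseGaussian p) {T : ℕ} (hT : 7 * (T : ℝ) ≤ 5 * l - 9) (t : ℕ)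
    (ht : p * 8 ^ t ≤ 13 * l) :
    μ {ω | HasSpreadObstruction (perturb Abar κ (fun e => X e ω))
        (Real.exp (-(7 * ((t + 1 : ℕ) : ℝ) + 1) * L)) (Real.exp (-(7 * (t : ℝ) + 1) * L)) (8 ^ t)
        ⌈1 / Real.exp (-(7 * (T : ℝ) + 1) * L) + 1⌉₊}
      ≤ ENNReal.ofReal (Real.exp (-12 * l)) := by
  have hl := P.eleven_le
  have hL := P.le_L
  have hn := P.le_n
  have hn0 : 0 < n := by
    have : (0 : ℝ) < n := by linarith
    exact_mod_cast this
  have hκ0 : 0 < κ := by rw [P.κ_eq]; positivity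
  refine (SparsePerturbation.measure_hasSpreadObstruction_le hn0 hκ0 ⟨P.p_pos.le, P.p_le⟩ hX hind
    hlaw (Real.exp_pos _) (Real.exp_pos _) _ _).trans (ENNReal.ofReal_le_ofReal ?_)
  refine P.spread_bound (by positivity) (by push_cast; exact ht) (by positivity) ?_ ?_
  · have h16 := P.le_exp (c := 16) (by norm_num)
    have h4 : (n : ℝ) ^ 2 = Real.exp (2 * l) := by exact_mod_cast P.n_pow 2
    rw [h4, P.κ_eq, div_le_iff₀ (Real.exp_pos _)]
    calc _ ≤ Real.exp l * Real.exp (-(7 * ((t + 1 : ℕ) : ℝ) + 1) * L) *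
          (Real.exp (2 * l) * Real.exp L) := by gcongr
      _ = Real.exp (l + -(7 * ((t + 1 : ℕ) : ℝ) + 1) * L + (2 * l + L)) := by
        simp only [Real.exp_add]
      _ ≤ Real.exp (-14 * l + -(7 * (t : ℝ) + 1) * L) := by
        rw [Real.exp_le_exp]; push_cast; linarith
      _ = _ := by rw [Real.exp_add]
  · have h1 : (⌈1 / Real.exp (-(7 * (T : ℝ) + 1) * L) + 1⌉₊ : ℝ)
        ≤ Real.exp ((7 * (T : ℝ) + 1) * L) + 2 := by
      have := Nat.ceil_lt_add_one (a := 1 / Real.exp (-(7 * (T : ℝ) + 1) * L) + 1) (by positivity)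
      rw [one_div, ← Real.exp_neg] at this
      rw [one_div, ← Real.exp_neg]
      rw [show -(-(7 * (T : ℝ) + 1) * L) = (7 * (T : ℝ) + 1) * L by ring] at this ⊢
      linarith
    have h2 : 1 ≤ Real.exp ((7 * (T : ℝ) + 1) * L) := by
      apply Real.one_le_exp
      have : 0 ≤ L := by linarith
      positivity
    calc _ ≤ (n : ℝ) * (7 * Real.exp ((7 * (T : ℝ) + 1) * L)) := by
          gcongr; linarith
      _ ≤ Real.exp l * (Real.exp l * Real.exp ((7 * (T : ℝ) + 1) * L)) := by
          rw [P.n_eq]; gcongr; exact P.le_exp (by norm_num)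
      _ = Real.exp (l + (l + (7 * (T : ℝ) + 1) * L)) := by simp only [Real.exp_add]
      _ ≤ Real.exp (5 * L * l) := by
          rw [Real.exp_le_exp]
          have : (7 * (T : ℝ)) * L ≤ (5 * l - 9) * L :=
            mul_le_mul_of_nonneg_right hT (by linarith)
          linarith

/-- The slack 9 in 7T ≤ 5l - 9 pays for the noise scale κ, for the extra κ in the last threshold,
and for the powers of n. -/
lemma Parameters.measure_isColumnObstruction_le (P : Parameters n κ p l L)
    (hX : ∀ e, Measurable (X e)) (hind : iIndepFun X μ)
    (hlaw : ∀ e, μ.map (X e) = sparseGaussian p) (hA : Abar.IsHermitian) {m T : ℕ}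
    (hT : 7 * (T : ℝ) ≤ 5 * l - 9) (hm : 13 * l ≤ p * m) (k j : Fin n) :
    μ {ω | IsColumnObstruction hA κ (Real.exp (-(5 * L * l)))
        (Real.exp (-(7 * (T : ℝ) + 1) * L)) (4 * (n : ℝ) ^ 4 * Real.exp (-(5 * L * l))) m k j
        (fun e => X e ω)}
      ≤ ENNReal.ofReal (2 * Real.exp (-13 * l)) := by
  have hl := P.eleven_le
  have hL := P.le_L
  have hκ0 : 0 < κ := by rw [P.κ_eq]; positivity
  refine (SparsePerturbation.measure_isColumnObstruction_le (Fin.pos k) hκ0 ⟨P.p_pos.le, P.p_le⟩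
    hX hind hlaw hA (Real.exp_pos _) (by positivity) m k j).trans (ENNReal.ofReal_le_ofReal ?_)
  have h1 : (1 - p) ^ m ≤ Real.exp (-13 * l) := by
    have : 1 - p ≤ Real.exp (-p) := by linarith [Real.add_one_le_exp (-p)]
    calc (1 - p) ^ m ≤ Real.exp (-p) ^ m :=
          pow_le_pow_left₀ (by linarith [P.p_le]) this m
      _ = Real.exp (-(p * m)) := by rw [← Real.exp_nat_mul]; ring_nf
      _ ≤ _ := by rw [Real.exp_le_exp]; linarith
  have h2 : 4 * (n : ℝ) ^ 4 * Real.exp (-(5 * L * l)) * ((n : ℝ) ^ 2 * κ)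
      / Real.exp (-(7 * (T : ℝ) + 1) * L) ≤ Real.exp (-13 * l) := by
    have h3 : (n : ℝ) ^ 2 = Real.exp (2 * l) := by exact_mod_cast P.n_pow 2
    have h4 : (n : ℝ) ^ 4 = Real.exp (4 * l) := by exact_mod_cast P.n_pow 4
    rw [h3, h4, P.κ_eq, div_le_iff₀ (Real.exp_pos _)]
    calc _ ≤ Real.exp l * Real.exp (4 * l) * Real.exp (-(5 * L * l)) *
          (Real.exp (2 * l) * Real.exp L) := by
          gcongr; exact P.le_exp (by norm_num)
      _ = Real.exp (l + 4 * l + -(5 * L * l) + (2 * l + L)) := by simp only [Real.exp_add]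
      _ ≤ Real.exp (-13 * l + -(7 * (T : ℝ) + 1) * L) := by
        rw [Real.exp_le_exp]
        have : (7 * (T : ℝ)) * L ≤ (5 * l - 9) * L :=
          mul_le_mul_of_nonneg_right hT (by linarith)
        linarith
      _ = _ := by rw [Real.exp_add]
  linarith

lemma Parameters.measure_not_eigenvaluesSeparated_le (P : Parameters n κ p l L)
    (hX : ∀ e, Measurable (X e)) (hind : iIndepFun X μ)
    (hlaw : ∀ e, μ.map (X e) = sparseGaussian p) (hA : Abar.IsHermitian)
    (hAb : ∀ i j, |Abar i j| ≤ 1 / n) :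
    μ {ω | ¬ EigenvaluesSeparated (perturb Abar κ (fun e => X e ω)) (κ ^ (-5 * l))}
      ≤ ENNReal.ofReal ((n : ℝ) ^ (-10 : ℤ)) := by
  have hl := P.eleven_le
  have hL := P.le_L
  have hn := P.le_n
  have hnR : (0 : ℝ) < n := by linarith
  have hn0 : 0 < n := by exact_mod_cast hnR
  have hκ1 : 1 ≤ κ := by rw [P.κ_eq]; apply Real.one_le_exp; linarith
  obtain ⟨m, T, hm, hmT, hTn, hT, hlt⟩ := P.exists_clog_bound
  rw [P.κ_rpow]
  set δ := Real.exp (-(5 * L * l)) with hδ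
  set a : ℕ → ℝ := fun t => Real.exp (-(7 * (t : ℝ) + 1) * L) with ha
  have h7 : (7 * (T : ℝ)) * L ≤ (5 * l - 9) * L := mul_le_mul_of_nonneg_right hT (by linarith)
  have hT0 : (0 : ℝ) ≤ (7 * (T : ℝ)) * L := by
    have : 0 ≤ L := by linarith
    positivity
  let E₁ : Set Ω := {ω | ∃ e, n * κ < |X e ω|}
  let E₂ : ℕ → Set Ω := fun t => {ω | HasSpreadObstruction (perturb Abar κ (fun e => X e ω))
    (a (t + 1)) (a t) (8 ^ t) ⌈1 / a T + 1⌉₊}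
  let E₃ : Fin n × Fin n → Set Ω := fun q => {ω | IsColumnObstruction hA κ δ (a T)
    (4 * (n : ℝ) ^ 4 * δ) m q.1 q.2 (fun e => X e ω)}
  have hsub : {ω | ¬ EigenvaluesSeparated (perturb Abar κ (fun e => X e ω)) δ} ⊆
      (E₁ ∪ ⋃ t ∈ Finset.range T, E₂ t) ∪ ⋃ q ∈ (Finset.univ : Finset (Fin n × Fin n)), E₃ q := by
    intro ω hω
    by_contra hcon
    simp only [Set.mem_union, Set.mem_iUnion, not_or, not_exists, Finset.mem_range,
      Finset.mem_univ, true_imp_iff] at hcon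
    obtain ⟨⟨h1, h2⟩, h3⟩ := hcon
    refine hω (eigenvaluesSeparated_of_not_obstruction hn0 hκ1 hA hAb (fun e => ?_)
      (Real.exp_pos _) ?_ (a := a) (T := T) (fun t => Real.exp_pos _) (fun t => ?_)
      (Nat.le_ceil _) ?_ ?_ hTn hmT (fun t ht => h2 t ht) (fun k j => h3 (k, j)))
    · by_contra! h
      exact h1 ⟨e, h⟩
    · have h4 : (n : ℝ) ^ 2 = Real.exp (2 * l) := by exact_mod_cast P.n_pow 2
      calc 2 * (n : ℝ) ^ 2 * δ ≤ Real.exp l * Real.exp (2 * l) * Real.exp (-(5 * L * l)) := by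
            rw [h4]; gcongr; exact P.le_exp (by norm_num)
        _ = Real.exp (l + 2 * l + -(5 * L * l)) := by simp only [Real.exp_add]
        _ ≤ 1 := by rw [Real.exp_le_one_iff]; linarith
    · rw [le_div_iff₀ two_pos]
      calc a (t + 1) * 2 ≤ Real.exp (-(7 * ((t + 1 : ℕ) : ℝ) + 1) * L) * Real.exp l := by
            gcongr; exact P.le_exp (by norm_num)
        _ = Real.exp (-(7 * ((t + 1 : ℕ) : ℝ) + 1) * L + l) := by rw [Real.exp_add]
        _ ≤ a t := by rw [ha, Real.exp_le_exp]; push_cast; linarith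
    · rw [P.n_eq, one_div, ← Real.exp_neg, ha, Real.exp_le_exp]; push_cast; linarith
    · rw [P.n_eq, hδ, ha, ← Real.exp_add, Real.exp_le_exp]; linarith
  have b1 : μ E₁ ≤ ENNReal.ofReal (Real.exp (-11 * l)) := P.measure_abs_gt_le hX hlaw
  have b2 : μ (⋃ t ∈ Finset.range T, E₂ t) ≤ ENNReal.ofReal (Real.exp (-11 * l)) := by
    calc _ ≤ ∑ t ∈ Finset.range T, ENNReal.ofReal (Real.exp (-12 * l)) :=
          (measure_biUnion_finset_le _ _).trans (Finset.sum_le_sum fun t ht =>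
            P.measure_hasSpreadObstruction_le hX hind hlaw hT t (hlt t (Finset.mem_range.1 ht)))
      _ = ENNReal.ofReal (T * Real.exp (-12 * l)) := by
          rw [ENNReal.ofReal_mul (by positivity)]; simp
      _ ≤ _ := by
          apply ENNReal.ofReal_le_ofReal
          have hTn' : (T : ℝ) ≤ Real.exp l := by
            rw [← P.n_eq]; exact_mod_cast (Nat.lt_pow_self (by norm_num)).le.trans hTn
          calc (T : ℝ) * Real.exp (-12 * l) ≤ Real.exp l * Real.exp (-12 * l) := by gcongr
            _ = _ := by rw [← Real.exp_add]; ring_nf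
  have b3 : μ (⋃ q ∈ (Finset.univ : Finset (Fin n × Fin n)), E₃ q)
      ≤ ENNReal.ofReal (2 * Real.exp (-11 * l)) := by
    calc _ ≤ ∑ _q : Fin n × Fin n, ENNReal.ofReal (2 * Real.exp (-13 * l)) :=
          (measure_biUnion_finset_le _ _).trans (Finset.sum_le_sum fun q _ =>
            P.measure_isColumnObstruction_le hX hind hlaw hA hT hm q.1 q.2)
      _ = ENNReal.ofReal ((n : ℝ) ^ 2 * (2 * Real.exp (-13 * l))) := by
          rw [Finset.sum_const, nsmul_eq_mul, ENNReal.ofReal_mul (p := (n : ℝ) ^ 2) (by positivity)]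
          congr 1
          simp [sq]
      _ = _ := by
          have h4 : (n : ℝ) ^ 2 = Real.exp (2 * l) := by exact_mod_cast P.n_pow 2
          congr 1
          rw [h4, mul_left_comm, ← Real.exp_add]; ring_nf
  refine (measure_mono hsub).trans ((measure_union_le _ _).trans
    ((add_le_add ((measure_union_le _ _).trans (add_le_add b1 b2)) b3).trans ?_))
  rw [← ENNReal.ofReal_add (by positivity) (by positivity),
    ← ENNReal.ofReal_add (by positivity) (by positivity)]
  apply ENNReal.ofReal_le_ofReal
  have h10 : (n : ℝ) ^ (-10 : ℤ) = Real.exp (-10 * l) := by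
    rw [zpow_neg, neg_mul, Real.exp_neg]
    congr 1
    exact_mod_cast P.n_pow 10
  rw [h10]
  -- The noise and spreading events contribute n^(-11) each, and the n² column events together
  -- 2n^(-11).
  calc _ = 4 * Real.exp (-11 * l) := by ring
    _ ≤ Real.exp l * Real.exp (-11 * l) := by gcongr; exact P.le_exp (by norm_num)
    _ = _ := by rw [← Real.exp_add]; ring_nf

end Final

end SparsePerturbation

/-! ### The main theorem -/

theorem mainTheorem3 {n : ℕ} (Abar : Matrix (Fin n) (Fin n) ℝ) (κ p : ℝ)
    (hAbar : Abar.PosDef)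
    (hentries : ∀ i j, Abar i j ≤ 1 / (n : ℝ))
    (heig : ∀ i, 1 / κ ≤ hAbar.isHermitian.eigenvalues i)
    (hκ : (n : ℝ) ^ 3 ≤ κ)
    (hp : 300 * Real.log κ * Real.log n / n ≤ p) (hp1 : p ≤ 1)
    {Ω : Type*} [MeasurableSpace Ω] (μ : Measure Ω) [IsProbabilityMeasure μ]
    (X : Sym2 (Fin n) → Ω → ℝ)
    (hlaw : ∀ e, HasLaw (X e) (SparsePerturbation.sparseGaussian p) μ)
    (hindep : iIndepFun X μ) :
    1 - (n : ℝ) ^ (-10 : ℤ) ≤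
      μ.real {ω | SparsePerturbation.EigenvaluesSeparated
        (SparsePerturbation.perturb Abar κ (fun e => X e ω)) (κ ^ (-5 * Real.log n))} := by
  open SparsePerturbation in
  rcases lt_or_ge n 2 with hn | hn
  · have hsep : ∀ ω, EigenvaluesSeparated (perturb Abar κ (fun e => X e ω))
        (κ ^ (-5 * Real.log n)) := fun ω =>
      ⟨isHermitian_perturb hAbar.isHermitian κ _, fun i j hij => absurd (Fin.ext (by omega)) hij⟩
    simp only [hsep]
    simp
  -- The noise is only almost everywhere measurable, so it is replaced by measurable versions, which
  -- change the event by a null set.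
  let Y : Sym2 (Fin n) → Ω → ℝ := fun e => (hlaw e).aemeasurable.mk (X e)
  have hXY : ∀ e, X e =ᵐ[μ] Y e := fun e => (hlaw e).aemeasurable.ae_eq_mk
  have hY : ∀ e, Measurable (Y e) := fun e => (hlaw e).aemeasurable.measurable_mk
  have hYind : iIndepFun Y μ := hindep.congr hXY
  have hYlaw : ∀ e, μ.map (Y e) = sparseGaussian p := fun e => by
    rw [← Measure.map_congr (hXY e), (hlaw e).map_eq]
  have hbad := (parameters_of_le hn hκ hp hp1).measure_not_eigenvaluesSeparated_le hY hYind hYlaw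
    hAbar.isHermitian (abs_apply_le_of_posDef hAbar hentries)
  set S : Set Ω := {ω | EigenvaluesSeparated (perturb Abar κ (fun e => Y e ω))
    (κ ^ (-5 * Real.log n))} with hS
  have hSX : μ.real {ω | EigenvaluesSeparated (perturb Abar κ (fun e => X e ω))
      (κ ^ (-5 * Real.log n))} = μ.real S := by
    refine measureReal_congr ?_
    filter_upwards [ae_all_iff.2 hXY] with ω hω
    have : (fun e => X e ω) = fun e => Y e ω := funext hω
    apply propext
    change EigenvaluesSeparated (perturb Abar κ fun e => X e ω) _ ↔
      EigenvaluesSeparated (perturb Abar κ fun e => Y e ω) _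
    rw [this]
  rw [hSX]
  have hreal : μ.real Sᶜ ≤ (n : ℝ) ^ (-10 : ℤ) :=
    ENNReal.toReal_le_of_le_ofReal (by positivity) hbad
  -- Subadditivity alone is used, so measurability of the separation event is not required.
  have huniv : μ.real (S ∪ Sᶜ) ≤ μ.real S + μ.real Sᶜ := measureReal_union_le S Sᶜ
  rw [Set.union_compl_self, probReal_univ] at huniv
  linarith
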